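/- Let $\tfrac12<\alpha,\beta<1$, let $B$ be a standard Brownian sheet on $[0,\infty)^2$, and let $\mathrm B(\cdot,\cdot)$ denote the Beta function. For $H\in(\tfrac12,1)$ put $c_H=\sqrt{\dfrac{H(2H-1)}{\mathrm B(2-2H,H-\frac12)}}$, $H'=\dfrac{H+1}2$, $d_H=\dfrac1{H+1}\sqrt{\dfrac{2(2H-1)}{H}}$, $$K^H(x,y)=c_H\,y^{\frac12-H}\int_y^x(u-y)^{H-\frac32}u^{H-\frac12}\,du\qquad(x>y>0),$$ $$Q_H(t,y_1,y_2)=d_H\,1_{[0,t]}(y_1)1_{[0,t]}(y_2)\int_{y_1\vee y_2}^t\frac{\partial K^{H'}}{\partial x}(x,y_1)\frac{\partial K^{H'}}{\partial x}(x,y_2)\,dx .$$ The Rosenblatt sheet is the double Wiener integral $$Z^{\alpha,\beta}(t,s)=\int_0^t\!\!\int_0^s\!\!\int_0^t\!\!\int_0^sQ_\alpha(t,y_1,y_2)\,Q_\beta(s,u_1,u_2)\,B(dy_1,du_1)B(dy_2,du_2).$$ For $k_1,k_2\ge0$ let $$\zeta(y_1,y_2,u_1,u_2)=k_1(y_1y_2)^{-\frac\alpha2}(u_1u_2)^{-\frac\beta2}+k_2\,(y_1\vee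 y_2)^{\frac\alpha2}(y_1\wedge y_2)^{-\frac\alpha2}|y_1-y_2|^{\alpha-1}(u_1\vee u_2)^{\frac\beta2}(u_1\wedge u_2)^{-\frac\beta2}|u_1-u_2|^{\beta-1}$$ and $$M_{t,s}(\zeta)=\int_0^t\!\!\int_0^s\!\!\int_0^t\!\!\int_0^s\zeta(y_1,y_2,u_1,u_2)\,B(dy_1,du_1)B(dy_2,du_2).$$ Put $C_1(\alpha)=d_\alpha c_{\alpha'}^2\,\mathrm B(1-\alpha,\tfrac\alpha2)^2$, $$C_2(\alpha)=d_\alpha c_{\alpha'}^2\int_0^1\!\!\int_0^s r^{-\alpha}(1-s)^{\frac\alpha2-1}(1-r)^{\frac\alpha2-1}(s-r)^{\alpha-1}\,dr\,ds,$$ $$a(k_2)=1+\frac{4k_2^2}{\alpha\beta}\mathrm B(1-\alpha,2\alpha-1)\mathrm B(1-\beta,2\beta-1)-\frac{8k_2}{\alpha\beta}C_2(\alpha)C_2(\beta),$$ $$b(k_2)=C_1(\alpha)C_1(\beta)-4k_2\,\mathrm B(1-\alpha,\alpha)\,\mathrm B(1-\beta,\beta).$$ Then, for all $k_1,k_2\ge0$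 and all $t,s\ge0$, both double Wiener integrals $Z^{\alpha,\beta}(t,s)$ and $M_{t,s}(\zeta)$ exist (as $L^2$ random variables), and $f(t,s,k_1,k_2):=2E\big(Z^{\alpha,\beta}(t,s)-M_{t,s}(\zeta)\big)^2$ satisfies $$f(t,s,k_1,k_2)=a(k_2)\,t^{2\alpha}s^{2\beta}-8k_1b(k_2)\,ts+4k_1^2\,\frac{t^{2-2\alpha}s^{2-2\beta}}{(1-\alpha)^2(1-\beta)^2}.$$ -/

import Mathlib

open MeasureTheory ProbabilityTheory Filter Topology Set
open scoped NNReal ENNReal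

namespace RosenblattSheet

/-! ### The Brownian sheet -/

/-- A standard Brownian sheet on `[0, ∞)²`: a centred Gaussian process with covariance
`E[B(x) B(y)] = min(x₁, y₁) min(x₂, y₂)`. Path continuity plays no role for Wiener integrals
and is not required. -/
structure IsBrownianSheet {Ω : Type*} [MeasurableSpace Ω] (B : ℝ≥0 × ℝ≥0 → Ω → ℝ)
    (P : Measure Ω) : Prop where
  gaussian : IsGaussianProcess B P
  centred : ∀ x, ∫ ω, B x ω ∂P = 0
  covariance : ∀ x y, ∫ ω, B x ω * B y ω ∂P = (min x.1 y.1 : ℝ≥0) * (min x.2 y.2 : ℝ≥0)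

/-! ### The double Wiener integral -/

/-- A half-open rectangle `(a, b] × (c, d]` in the quadrant `[0, ∞)²`. -/
structure Rect where
  a : ℝ≥0
  b : ℝ≥0
  c : ℝ≥0
  d : ℝ≥0
  hab : a ≤ b
  hcd : c ≤ d

/-- The rectangle as a subset of the plane. -/
def Rect.toSet (R : Rect) : Set (ℝ × ℝ) := Ioc (R.a : ℝ) R.b ×ˢ Ioc (R.c : ℝ) R.d

/-- The increment of the sheet over a rectangle, that is, its random measure. -/
def Rect.incr {Ω : Type*} (R : Rect) (B : ℝ≥0 × ℝ≥0 → Ω → ℝ) (ω : Ω) : ℝ :=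
  B (R.b, R.d) ω - B (R.a, R.d) ω - B (R.b, R.c) ω + B (R.a, R.c) ω

/-- A term `c · 1_{R × R'}` with `R` and `R'` disjoint, so that it vanishes on the diagonal. -/
structure OffDiagTerm where
  coeff : ℝ
  left : Rect
  right : Rect
  disjoint : Disjoint left.toSet right.toSet

/-- The elementary function `∑ c · 1_{R × R'}`. A point is written `((y₁, u₁), (y₂, u₂))`.
These sums are exactly the elementary functions
`∑ a_{ij} 1_{A_i × A_j}`, `a_{ii} = 0`, over pairwise disjoint rectangles `A_i`. -/
noncomputable def elemFun (L : List OffDiagTerm) (p : (ℝ × ℝ) × (ℝ × ℝ)) : ℝ :=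
  (L.map fun e => (e.left.toSet ×ˢ e.right.toSet).indicator (fun _ => e.coeff) p).sum

/-- The double integral `∑ c · B(R) B(R')` of an elementary function. -/
def elemIntegral {Ω : Type*} (B : ℝ≥0 × ℝ≥0 → Ω → ℝ) (L : List OffDiagTerm) (ω : Ω) : ℝ :=
  (L.map fun e => e.coeff * (e.left.incr B ω * e.right.incr B ω)).sum

/-- `X` is (a version of) the double Wiener integral
`∫∫ g((y₁, u₁), (y₂, u₂)) B(dy₁, du₁) B(dy₂, du₂)` of the square integrable function `g`: for
some sequence of elementary functions that converges to `g` in `L²`, the integrals converge to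
`X` in `L²(P)`. -/
structure IsDoubleWienerIntegral {Ω : Type*} [MeasurableSpace Ω] (B : ℝ≥0 × ℝ≥0 → Ω → ℝ)
    (P : Measure Ω) (g : (ℝ × ℝ) × (ℝ × ℝ) → ℝ) (X : Ω → ℝ) : Prop where
  memLp_integrand : MemLp g 2 volume
  memLp : MemLp X 2 P
  exists_approx : ∃ L : ℕ → List OffDiagTerm,
    Tendsto (fun n => eLpNorm (fun p => g p - elemFun (L n) p) 2 volume) atTop (𝓝 0) ∧
    Tendsto (fun n => eLpNorm (fun ω => X ω - elemIntegral B (L n) ω) 2 P) atTop (𝓝 0)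

open Classical in
/-- The double Wiener integral of `g` with respect to the Brownian sheet `B`, a random variable
chosen in its almost sure class (and `0` if the integral does not exist). -/
noncomputable def doubleWienerIntegral {Ω : Type*} [MeasurableSpace Ω] (B : ℝ≥0 × ℝ≥0 → Ω → ℝ)
    (P : Measure Ω) (g : (ℝ × ℝ) × (ℝ × ℝ) → ℝ) : Ω → ℝ :=
  if h : ∃ X, IsDoubleWienerIntegral B P g X then h.choose else 0

/-! ### The Rosenblatt sheet -/

/-- `c_H = √(H (2H - 1) / B(2 - 2H, H - 1/2))`. -/
noncomputable def cConst (H : ℝ) : ℝ :=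
  √(H * (2 * H - 1) / ProbabilityTheory.beta (2 - 2 * H) (H - 1 / 2))

/-- The kernel `K^H(x, y) = c_H y^{1/2 - H} ∫_y^x (u - y)^{H - 3/2} u^{H - 1/2} du` of fractional
Brownian motion, for `x > y > 0`. -/
noncomputable def K (H x y : ℝ) : ℝ :=
  cConst H * y ^ (1 / 2 - H) * ∫ u in y..x, (u - y) ^ (H - 3 / 2) * u ^ (H - 1 / 2)

/-- The normalizing constant `d_H = (1 / (H + 1)) √(2 (2H - 1) / H)`. -/
noncomputable def dConst (H : ℝ) : ℝ :=
  1 / (H + 1) * √(2 * (2 * H - 1) / H)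

/-- `Q_H(t, y₁, y₂) = d_H 1_{[0,t]}(y₁) 1_{[0,t]}(y₂)
∫_{y₁ ∨ y₂}^t ∂ₓK^{H'}(x, y₁) ∂ₓK^{H'}(x, y₂) dx`, with `H' = (H + 1) / 2`. -/
noncomputable def Q (H t y₁ y₂ : ℝ) : ℝ :=
  dConst H * (Icc 0 t).indicator 1 y₁ * (Icc 0 t).indicator 1 y₂ *
    ∫ x in (max y₁ y₂)..t,
      deriv (fun x' => K ((H + 1) / 2) x' y₁) x * deriv (fun x' => K ((H + 1) / 2) x' y₂) x

/-- The kernel `Q_α(t, y₁, y₂) Q_β(s, u₁, u₂)` of the Rosenblatt sheet. -/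
noncomputable def sheetKernel (α β t s : ℝ) (p : (ℝ × ℝ) × (ℝ × ℝ)) : ℝ :=
  Q α t p.1.1 p.2.1 * Q β s p.1.2 p.2.2

/-- The Rosenblatt sheet `Z^{α,β}(t, s)`. -/
noncomputable def rosenblattSheet {Ω : Type*} [MeasurableSpace Ω] (B : ℝ≥0 × ℝ≥0 → Ω → ℝ)
    (P : Measure Ω) (α β t s : ℝ) : Ω → ℝ :=
  doubleWienerIntegral B P (sheetKernel α β t s)

/-! ### The approximating integrals -/

/-- The function `ζ(y₁, y₂, u₁, u₂)` cut off to `[0, t]² × [0, s]²`. -/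
noncomputable def cutoff (ζ : ℝ → ℝ → ℝ → ℝ → ℝ) (t s : ℝ) (p : (ℝ × ℝ) × (ℝ × ℝ)) : ℝ :=
  ((Icc 0 t ×ˢ Icc 0 s) ×ˢ (Icc 0 t ×ˢ Icc 0 s)).indicator
    (fun q => ζ q.1.1 q.2.1 q.1.2 q.2.2) p

/-- `M_{t,s}(ζ) = ∫₀ᵗ∫₀ˢ∫₀ᵗ∫₀ˢ ζ(y₁, y₂, u₁, u₂) B(dy₁, du₁) B(dy₂, du₂)`. -/
noncomputable def M {Ω : Type*} [MeasurableSpace Ω] (B : ℝ≥0 × ℝ≥0 → Ω → ℝ)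
    (P : Measure Ω) (ζ : ℝ → ℝ → ℝ → ℝ → ℝ) (t s : ℝ) : Ω → ℝ :=
  doubleWienerIntegral B P (cutoff ζ t s)

/-- `(y₁ ∨ y₂)^{α/2} (y₁ ∧ y₂)^{-α/2} |y₁ - y₂|^{α - 1}`. -/
noncomputable def singularKernel (α y₁ y₂ : ℝ) : ℝ :=
  (max y₁ y₂) ^ (α / 2) * (min y₁ y₂) ^ (-(α / 2)) * |y₁ - y₂| ^ (α - 1)

/-- The member of the class `𝒦` with coefficients `k₁` and `k₂`. -/
noncomputable def zeta (α β k₁ k₂ y₁ y₂ u₁ u₂ : ℝ) : ℝ :=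
  k₁ * (y₁ * y₂) ^ (-(α / 2)) * (u₁ * u₂) ^ (-(β / 2)) +
    k₂ * singularKernel α y₁ y₂ * singularKernel β u₁ u₂

/-- `f(t, s, k₁, k₂) = 2 E[Z^{α,β}(t, s) - M_{t,s}(ζ)]²`. -/
noncomputable def f {Ω : Type*} [MeasurableSpace Ω] (B : ℝ≥0 × ℝ≥0 → Ω → ℝ)
    (P : Measure Ω) (α β t s k₁ k₂ : ℝ) : ℝ :=
  2 * ∫ ω, (rosenblattSheet B P α β t s ω - M B P (zeta α β k₁ k₂) t s ω) ^ 2 ∂P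

/-! ### The constants -/

/-- `C₁(α) = d_α c_{α'}² B(1 - α, α/2)²`, with `α' = (α + 1) / 2`. -/
noncomputable def C₁ (α : ℝ) : ℝ :=
  dConst α * cConst ((α + 1) / 2) ^ 2 * ProbabilityTheory.beta (1 - α) (α / 2) ^ 2

/-- `C₂(α) = d_α c_{α'}² ∫₀¹∫₀ˢ r^{-α} (1-s)^{α/2-1} (1-r)^{α/2-1} (s-r)^{α-1} dr ds`. -/
noncomputable def C₂ (α : ℝ) : ℝ :=
  dConst α * cConst ((α + 1) / 2) ^ 2 *
    ∫ s in (0 : ℝ)..1, ∫ r in (0 : ℝ)..s,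
      r ^ (-α) * (1 - s) ^ (α / 2 - 1) * (1 - r) ^ (α / 2 - 1) * (s - r) ^ (α - 1)

/-- `a(k₂)`. -/
noncomputable def aCoeff (α β k₂ : ℝ) : ℝ :=
  1 + 4 * k₂ ^ 2 / (α * β) * ProbabilityTheory.beta (1 - α) (2 * α - 1) *
        ProbabilityTheory.beta (1 - β) (2 * β - 1)
    - 8 * k₂ / (α * β) * C₂ α * C₂ β

/-- `b(k₂)`. -/
noncomputable def bCoeff (α β k₂ : ℝ) : ℝ :=
  C₁ α * C₁ β -
    4 * k₂ * ProbabilityTheory.beta (1 - α) α * ProbabilityTheory.beta (1 - β) β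

end RosenblattSheet

namespace RosenblattSheet

/-! ### Moments of Gaussian variables -/

/-! The double Wiener integral of a symmetric kernel is, up to the factor `2`, an isometry: `E(I(g)
- I(g'))² = 2‖g - g'‖²`. Hence the mean square error is `4‖Q_α ⊗ Q_β - ζ‖²` in `L²` of the product
of two quadrants. Write `P` for the product kernel `(y₁y₂)^{-a/2}` and `S` for the singular kernel,
both cut off to `[0, t]²`. Then `ζ = k₁ P ⊗ P + k₂ S ⊗ S`, so every inner product in the expanded
square factors into one-parameter inner products among `Q`, `P` and `S`. These six numbers give
`a(k₂)`, `b(k₂)` and the last term.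

Probabilistic side. For elementary functions the isometry is Isserlis' formula
(`IsCentredGaussianSpace.integral_mul_mul`): of its three pairings, one vanishes because the two
rectangles of a term are disjoint, and the other two are the `L²` pairings of the kernels with and
without a swap (`OffDiagTerm.integral_stoch_mul_stoch`). Existence for general kernels needs density
of off-diagonal elementary functions, obtained from Lebesgue differentiation
(`ae_eq_zero_of_mem_orthogonal`). The second moment is computed for any version of the integrals, so
the choice of version is immaterial.

Analytic side. All kernels are nonnegative and are handled as `[0, ∞]`-valued functions on the whole
plane, with cut-offs built into truncated powers `posPow`; Tonelli then needs no integrability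
check. `Q` is a mixture over `x` of rank-one kernels `∂ₓK(x, y₁) ∂ₓK(x, y₂)`, so its pairings reduce
to one-variable Beta integrals. The central one is `∫ ∂ₓK(x, y) ∂ₓK(x', y) dy`, proportional to `|x
- x'|^{a-1}`, which a Möbius substitution evaluates (`lintegral_kernel_mul_kernel`). The pairing of
`Q` with `S` has no such closed form; homogeneity reduces it to the integral over the unit triangle
that defines `C₂` (`triangleL_eq`). -/

theorem integral_pow_four_gaussianReal (v : ℝ≥0) :
    ∫ x, x ^ 4 ∂(gaussianReal 0 v) = 3 * (v : ℝ) ^ 2 := by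
  have h := iteratedDeriv_mgf_zero (X := id) (μ := gaussianReal 0 v) (by simp) 4
  have hE : ∀ t : ℝ, HasDerivAt (fun t : ℝ => Real.exp (v * t ^ 2 / 2))
      (v * t * Real.exp (v * t ^ 2 / 2)) t := fun t => by
    have := (((hasDerivAt_pow 2 t).const_mul (v : ℝ)).div_const 2).exp
    convert! this using 1; push_cast; ring
  -- Every derivative of the moment generating function is a polynomial times the same exponential;
  -- differentiation sends `p` to `p' + v t p`. Four applications at `t = 0` give `3v²`.
  have key : ∀ (p p' : ℝ → ℝ), (∀ t, HasDerivAt p (p' t) t) →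
      deriv (fun t : ℝ => p t * Real.exp (v * t ^ 2 / 2)) =
        fun t => (p' t + p t * (v * t)) * Real.exp (v * t ^ 2 / 2) := fun p p' hp => by
    ext t
    rw [((hp t).fun_mul (hE t)).deriv]; ring
  have h1 : deriv (fun t : ℝ => Real.exp (v * t ^ 2 / 2)) =
      fun t => (v * t) * Real.exp (v * t ^ 2 / 2) := by
    ext t; exact (hE t).deriv
  have h2 := key (fun t => v * t) (fun _ => v) (fun t => by
    simpa using (hasDerivAt_id t).const_mul (v : ℝ))
  have h3 := key (fun t => v + v * t * (v * t)) (fun t => 2 * v ^ 2 * t) (fun t => by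
    have := (((hasDerivAt_id t).const_mul (v : ℝ)).mul
      ((hasDerivAt_id t).const_mul (v : ℝ))).const_add (v : ℝ)
    convert! this using 1; simp; ring)
  have h4 := key (fun t => 2 * v ^ 2 * t + (v + v * t * (v * t)) * (v * t))
    (fun t => 3 * v ^ 2 + 3 * v ^ 3 * t ^ 2) (fun t => by
    have := ((hasDerivAt_id t).const_mul (3 * (v : ℝ) ^ 2)).add
      ((hasDerivAt_pow 3 t).const_mul ((v : ℝ) ^ 3))
    convert! this using 1
    · ext s; simp; ring
    · simp; ring)
  rw [mgf_id_gaussianReal] at h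
  simp only [zero_mul, zero_add, iteratedDeriv_succ, iteratedDeriv_zero, h1, h2, h3, h4] at h
  simpa using h.symm

variable {Ω : Type*} [MeasurableSpace Ω] {P : Measure Ω}

theorem integral_pow_four_of_hasGaussianLaw {X : Ω → ℝ} (hX : HasGaussianLaw X P)
    (h0 : ∫ ω, X ω ∂P = 0) : ∫ ω, X ω ^ 4 ∂P = 3 * (∫ ω, X ω ^ 2 ∂P) ^ 2 := by
  have hvar : Var[X; P] = ∫ ω, X ω ^ 2 ∂P := by
    rw [variance_of_integral_eq_zero hX.aemeasurable h0]
  have h := integral_map (μ := P) hX.aemeasurable (f := fun x : ℝ => x ^ 4) (by fun_prop)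
  rw [← h, hX.map_eq_gaussianReal, h0, integral_pow_four_gaussianReal, hvar,
    Real.coe_toNNReal _ (integral_nonneg fun ω => sq_nonneg _)]

/-- A linear space of centred Gaussian variables. -/
structure IsCentredGaussianSpace (H : Submodule ℝ (Ω → ℝ)) (P : Measure Ω) : Prop where
  hasGaussianLaw : ∀ X ∈ H, HasGaussianLaw X P
  integral_eq_zero : ∀ X ∈ H, ∫ ω, X ω ∂P = 0

namespace IsCentredGaussianSpace

variable {H : Submodule ℝ (Ω → ℝ)} (hH : IsCentredGaussianSpace H P)
include hH

theorem integrable_mul {X Y : Ω → ℝ} (hX : X ∈ H) (hY : Y ∈ H) :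
    Integrable (fun ω => X ω * Y ω) P :=
  (hH.hasGaussianLaw X hX).memLp_two.integrable_mul (hH.hasGaussianLaw Y hY).memLp_two

theorem memLp_mul {X Y : Ω → ℝ} (hX : X ∈ H) (hY : Y ∈ H) :
    MemLp (fun ω => X ω * Y ω) 2 P := by
  have : ENNReal.HolderTriple 4 4 2 := ⟨by
    rw [← ENNReal.toReal_eq_toReal_iff' (by simp) (by simp),
      ENNReal.toReal_add (by simp) (by simp)]; norm_num⟩
  exact ((hH.hasGaussianLaw Y hY).memLp (p := 4) (by simp)).mul
    ((hH.hasGaussianLaw X hX).memLp (p := 4) (by simp))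

theorem integrable_mul_mul {X Y Z W : Ω → ℝ} (hX : X ∈ H) (hY : Y ∈ H) (hZ : Z ∈ H)
    (hW : W ∈ H) : Integrable (fun ω => (X ω * Y ω) * (Z ω * W ω)) P :=
  (hH.memLp_mul hX hY).integrable_mul (hH.memLp_mul hZ hW)

theorem integral_add_mul {X Y Z : Ω → ℝ} (hX : X ∈ H) (hY : Y ∈ H) (hZ : Z ∈ H) :
    ∫ ω, (X + Y) ω * Z ω ∂P = ∫ ω, X ω * Z ω ∂P + ∫ ω, Y ω * Z ω ∂P := by
  simp only [Pi.add_apply, add_mul]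
  exact integral_add (hH.integrable_mul hX hZ) (hH.integrable_mul hY hZ)

theorem integral_sub_mul {X Y Z : Ω → ℝ} (hX : X ∈ H) (hY : Y ∈ H) (hZ : Z ∈ H) :
    ∫ ω, (X - Y) ω * Z ω ∂P = ∫ ω, X ω * Z ω ∂P - ∫ ω, Y ω * Z ω ∂P := by
  simp only [Pi.sub_apply, sub_mul]
  exact integral_sub (hH.integrable_mul hX hZ) (hH.integrable_mul hY hZ)

theorem integral_pow_four {X : Ω → ℝ} (hX : X ∈ H) :
    ∫ ω, X ω ^ 4 ∂P = 3 * (∫ ω, X ω * X ω ∂P) ^ 2 := by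
  rw [integral_pow_four_of_hasGaussianLaw (hH.hasGaussianLaw X hX) (hH.integral_eq_zero X hX)]
  simp only [sq]

theorem integral_sq_add {X Y : Ω → ℝ} (hX : X ∈ H) (hY : Y ∈ H) :
    ∫ ω, (X + Y) ω * (X + Y) ω ∂P =
      ∫ ω, X ω * X ω ∂P + 2 * ∫ ω, X ω * Y ω ∂P + ∫ ω, Y ω * Y ω ∂P := by
  have hXY := H.add_mem hX hY
  rw [hH.integral_add_mul hX hY hXY]
  simp only [mul_comm _ ((X + Y) _)]
  rw [hH.integral_add_mul hX hY hX, hH.integral_add_mul hX hY hY]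
  simp only [mul_comm (Y _) (X _)]
  ring

theorem integral_sq_sub {X Y : Ω → ℝ} (hX : X ∈ H) (hY : Y ∈ H) :
    ∫ ω, (X - Y) ω * (X - Y) ω ∂P =
      ∫ ω, X ω * X ω ∂P - 2 * ∫ ω, X ω * Y ω ∂P + ∫ ω, Y ω * Y ω ∂P := by
  have hXY := H.sub_mem hX hY
  rw [hH.integral_sub_mul hX hY hXY]
  simp only [mul_comm _ ((X - Y) _)]
  rw [hH.integral_sub_mul hX hY hX, hH.integral_sub_mul hX hY hY]
  simp only [mul_comm (Y _) (X _)]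
  ring

/-- Polarization: `12 X²Y² = (X+Y)⁴ + (X-Y)⁴ - 2X⁴ - 2Y⁴`, and each fourth moment is three times a
squared variance because sums and differences stay in the space. -/
theorem integral_sq_mul_sq {X Y : Ω → ℝ} (hX : X ∈ H) (hY : Y ∈ H) :
    ∫ ω, (X ω * X ω) * (Y ω * Y ω) ∂P =
      (∫ ω, X ω * X ω ∂P) * (∫ ω, Y ω * Y ω ∂P) + 2 * (∫ ω, X ω * Y ω ∂P) ^ 2 := by
  have hs := H.add_mem hX hY
  have hd := H.sub_mem hX hY
  have e : ∀ ω, (X ω * X ω) * (Y ω * Y ω) =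
      (((X + Y) ω ^ 4 + (X - Y) ω ^ 4) - (2 * X ω ^ 4 + 2 * Y ω ^ 4)) / 12 := fun ω => by
    simp only [Pi.add_apply, Pi.sub_apply]; ring
  have hint : ∀ {Z : Ω → ℝ}, Z ∈ H → Integrable (fun ω => Z ω ^ 4) P := fun {Z} hZ => by
    convert! hH.integrable_mul_mul hZ hZ hZ hZ using 2; ring
  simp_rw [e]
  rw [integral_div, integral_sub ((hint hs).fun_add (hint hd))
    (((hint hX).const_mul 2).fun_add ((hint hY).const_mul 2)), integral_add (hint hs) (hint hd),
    integral_add ((hint hX).const_mul 2) ((hint hY).const_mul 2), integral_const_mul,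
    integral_const_mul, hH.integral_pow_four hs, hH.integral_pow_four hd, hH.integral_pow_four hX,
    hH.integral_pow_four hY, hH.integral_sq_add hX hY, hH.integral_sq_sub hX hY]
  ring

/-- Isserlis' formula for four centred jointly Gaussian variables. -/
theorem integral_mul_mul {X Y Z W : Ω → ℝ} (hX : X ∈ H) (hY : Y ∈ H) (hZ : Z ∈ H)
    (hW : W ∈ H) : ∫ ω, (X ω * Y ω) * (Z ω * W ω) ∂P =
      (∫ ω, X ω * Y ω ∂P) * (∫ ω, Z ω * W ω ∂P) + (∫ ω, X ω * Z ω ∂P) * (∫ ω, Y ω * W ω ∂P) +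
        (∫ ω, X ω * W ω ∂P) * (∫ ω, Y ω * Z ω ∂P) := by
  have hs := H.add_mem hX hY
  have hd := H.sub_mem hX hY
  have hs' := H.add_mem hZ hW
  have hd' := H.sub_mem hZ hW
  -- A second polarization: `4XY = (X+Y)² - (X-Y)²`, and likewise for `ZW`, leaves only products of
  -- two squares.
  have e : ∀ ω, (X ω * Y ω) * (Z ω * W ω) =
      ((((X + Y) ω * (X + Y) ω) * ((Z + W) ω * (Z + W) ω) +
        ((X - Y) ω * (X - Y) ω) * ((Z - W) ω * (Z - W) ω)) -
      (((X + Y) ω * (X + Y) ω) * ((Z - W) ω * (Z - W) ω) +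
        ((X - Y) ω * (X - Y) ω) * ((Z + W) ω * (Z + W) ω))) / 16 := fun ω => by
    simp only [Pi.add_apply, Pi.sub_apply]; ring
  simp_rw [e]
  have i1 := hH.integrable_mul_mul hs hs hs' hs'
  have i2 := hH.integrable_mul_mul hd hd hd' hd'
  have i3 := hH.integrable_mul_mul hs hs hd' hd'
  have i4 := hH.integrable_mul_mul hd hd hs' hs'
  have c1 : ∀ {U V T : Ω → ℝ}, U ∈ H → V ∈ H → T ∈ H →
      ∫ ω, T ω * (U + V) ω ∂P = ∫ ω, T ω * U ω ∂P + ∫ ω, T ω * V ω ∂P := fun hU hV hT => by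
    simp only [mul_comm _ ((_ + _ : Ω → ℝ) _)]
    rw [hH.integral_add_mul hU hV hT]; simp only [mul_comm]
  have c2 : ∀ {U V T : Ω → ℝ}, U ∈ H → V ∈ H → T ∈ H →
      ∫ ω, T ω * (U - V) ω ∂P = ∫ ω, T ω * U ω ∂P - ∫ ω, T ω * V ω ∂P := fun hU hV hT => by
    simp only [mul_comm _ ((_ - _ : Ω → ℝ) _)]
    rw [hH.integral_sub_mul hU hV hT]; simp only [mul_comm]
  rw [integral_div, integral_sub (i1.fun_add i2) (i3.fun_add i4), integral_add i1 i2, integral_add i3 i4,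
    hH.integral_sq_mul_sq hs hs', hH.integral_sq_mul_sq hd hd', hH.integral_sq_mul_sq hs hd',
    hH.integral_sq_mul_sq hd hs', hH.integral_sq_add hX hY, hH.integral_sq_sub hX hY,
    hH.integral_sq_add hZ hW, hH.integral_sq_sub hZ hW, hH.integral_add_mul hX hY hs',
    hH.integral_add_mul hX hY hd', hH.integral_sub_mul hX hY hs', hH.integral_sub_mul hX hY hd',
    c1 hZ hW hX, c1 hZ hW hY, c2 hZ hW hX, c2 hZ hW hY]
  ring

end IsCentredGaussianSpace

/-! ### Increments of the Brownian sheet -/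

variable {B : ℝ≥0 × ℝ≥0 → Ω → ℝ}

theorem IsBrownianSheet.isCentredGaussianSpace (hB : IsBrownianSheet B P) :
    IsCentredGaussianSpace (Submodule.span ℝ (range B)) P where
  hasGaussianLaw X hX := by
    obtain ⟨c, rfl⟩ := Finsupp.mem_span_range_iff_exists_finsupp.1 hX
    exact (hB.gaussian.smul c).hasGaussianLaw_sum (I := c.support)
  integral_eq_zero X hX := by
    have hi : ∀ x, Integrable (B x) P := fun x => (hB.gaussian.hasGaussianLaw_eval x).integrable
    have : Integrable X P ∧ ∫ ω, X ω ∂P = 0 := by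
      induction hX using Submodule.span_induction with
      | mem X hX => obtain ⟨x, rfl⟩ := hX; exact ⟨hi x, hB.centred x⟩
      | zero => simp
      | add X Y _ _ hX hY =>
        refine ⟨hX.1.add hY.1, ?_⟩
        simp only [Pi.add_apply]
        rw [integral_add hX.1 hY.1, hX.2, hY.2, add_zero]
      | smul a X _ hX =>
        refine ⟨hX.1.smul a, ?_⟩
        simp only [Pi.smul_apply]
        rw [integral_smul, hX.2, smul_zero]
    exact this.2

omit [MeasurableSpace Ω] in
theorem Rect.incr_eq (R : Rect) (B : ℝ≥0 × ℝ≥0 → Ω → ℝ) :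
    R.incr B = B (R.b, R.d) - B (R.a, R.d) - B (R.b, R.c) + B (R.a, R.c) := rfl

omit [MeasurableSpace Ω] in
theorem Rect.incr_mem (R : Rect) (B : ℝ≥0 × ℝ≥0 → Ω → ℝ) :
    R.incr B ∈ Submodule.span ℝ (range B) := by
  have h : ∀ x, B x ∈ Submodule.span ℝ (range B) := fun x =>
    Submodule.subset_span (mem_range_self x)
  rw [Rect.incr_eq]
  exact Submodule.add_mem _ (Submodule.sub_mem _ (Submodule.sub_mem _ (h _) (h _)) (h _)) (h _)

/-- The mixed second difference of the Brownian covariance `min` is the length of the overlap of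
`(a, b]` and `(a', b']`; it is used once in each coordinate of the sheet. -/
theorem min_increment_eq {a b a' b' : ℝ} (h : a ≤ b) (h' : a' ≤ b') :
    min b b' - min a b' - (min b a' - min a a') = max (min b b' - max a a') 0 := by
  grind

theorem IsBrownianSheet.integral_incr_mul_incr (hB : IsBrownianSheet B P) (R R' : Rect) :
    ∫ ω, R.incr B ω * R'.incr B ω ∂P = volume.real (R.toSet ∩ R'.toSet) := by
  have hH := hB.isCentredGaussianSpace
  have h : ∀ x, B x ∈ Submodule.span ℝ (range B) := fun x =>
    Submodule.subset_span (mem_range_self x)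
  have key : ∀ Z ∈ Submodule.span ℝ (range B), ∀ S : Rect,
      ∫ ω, S.incr B ω * Z ω ∂P = ∫ ω, B (S.b, S.d) ω * Z ω ∂P - ∫ ω, B (S.a, S.d) ω * Z ω ∂P
        - ∫ ω, B (S.b, S.c) ω * Z ω ∂P + ∫ ω, B (S.a, S.c) ω * Z ω ∂P := fun Z hZ S => by
    rw [Rect.incr_eq, hH.integral_add_mul (Submodule.sub_mem _ (Submodule.sub_mem _ (h _) (h _))
      (h _)) (h _) hZ, hH.integral_sub_mul (Submodule.sub_mem _ (h _) (h _)) (h _) hZ,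
      hH.integral_sub_mul (h _) (h _) hZ]
  have key' : ∀ x : ℝ≥0 × ℝ≥0, ∫ ω, B x ω * R'.incr B ω ∂P =
      ((min x.1 R'.b : ℝ≥0) - (min x.1 R'.a : ℝ≥0) : ℝ) *
        ((min x.2 R'.d : ℝ≥0) - (min x.2 R'.c : ℝ≥0)) := fun x => by
    simp_rw [mul_comm (B x _)]
    rw [key _ (h x)]
    simp only [hB.covariance]
    simp only [min_comm x.1, min_comm x.2]
    ring
  rw [key _ (R'.incr_mem B)]
  simp only [key']
  rw [Rect.toSet, Rect.toSet, Set.prod_inter_prod, Ioc_inter_Ioc, Ioc_inter_Ioc,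
    Measure.volume_eq_prod, measureReal_prod_prod, Real.volume_real_Ioc, Real.volume_real_Ioc]
  simp only [NNReal.coe_min]
  have e1 := min_increment_eq (NNReal.coe_le_coe.2 R.hab) (NNReal.coe_le_coe.2 R'.hab)
  have e2 := min_increment_eq (NNReal.coe_le_coe.2 R.hcd) (NNReal.coe_le_coe.2 R'.hcd)
  rw [← e1, ← e2]
  ring

/-! ### Elementary functions and their integrals -/

section ListSum

variable {α ι κ : Type*} [MeasurableSpace α] {μ : Measure α}

theorem integrable_fun_mul {f g : α → ℝ} (hf : MemLp f 2 μ) (hg : MemLp g 2 μ) :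
    Integrable (fun x => f x * g x) μ :=
  hf.integrable_mul hg

theorem memLp_list_sum {F : ι → α → ℝ} {p : ℝ≥0∞} (hF : ∀ i, MemLp (F i) p μ) (L : List ι) :
    MemLp (fun x => (L.map fun i => F i x).sum) p μ := by
  induction L with
  | nil => simp
  | cons i L ih =>
    simp only [List.map_cons, List.sum_cons]
    exact (hF i).add ih

/-- Bilinearity for list sums. It reduces the isometry for elementary functions to single terms, on
the probability space as well as for the plain and the swapped pairing of kernels. -/
theorem integral_list_sum_mul_list_sum {F : ι → α → ℝ} {G : κ → α → ℝ}
    (hF : ∀ i, MemLp (F i) 2 μ) (hG : ∀ j, MemLp (G j) 2 μ) (L : List ι) (L' : List κ) :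
    ∫ x, (L.map fun i => F i x).sum * (L'.map fun j => G j x).sum ∂μ =
      (L.map fun i => (L'.map fun j => ∫ x, F i x * G j x ∂μ).sum).sum := by
  have hone : ∀ i, ∫ x, F i x * (L'.map fun j => G j x).sum ∂μ =
      (L'.map fun j => ∫ x, F i x * G j x ∂μ).sum := fun i => by
    induction L' with
    | nil => simp
    | cons j L' ih =>
      simp only [List.map_cons, List.sum_cons, mul_add]
      rw [integral_add (integrable_fun_mul (hF i) (hG j))
        (integrable_fun_mul (hF i) (memLp_list_sum hG L')), ih]
  induction L with
  | nil => simp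
  | cons i L ih =>
    simp only [List.map_cons, List.sum_cons, add_mul]
    rw [integral_add (integrable_fun_mul (hF i) (memLp_list_sum hG L'))
      (integrable_fun_mul (memLp_list_sum hF L) (memLp_list_sum hG L')), ih, hone]

end ListSum

theorem Rect.measurableSet_toSet (R : Rect) : MeasurableSet R.toSet :=
  measurableSet_Ioc.prod measurableSet_Ioc

theorem Rect.volume_toSet_lt_top (R : Rect) : volume R.toSet < ∞ := by
  rw [Rect.toSet, Measure.volume_eq_prod, Measure.prod_prod]
  simp [Real.volume_Ioc, ENNReal.mul_lt_top_iff]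

/-- The elementary function of a single term. -/
noncomputable def OffDiagTerm.fn (e : OffDiagTerm) (p : (ℝ × ℝ) × (ℝ × ℝ)) : ℝ :=
  (e.left.toSet ×ˢ e.right.toSet).indicator (fun _ => e.coeff) p

theorem OffDiagTerm.volume_prod_lt_top (e : OffDiagTerm) :
    volume (e.left.toSet ×ˢ e.right.toSet) < ∞ := by
  rw [Measure.volume_eq_prod, Measure.prod_prod]
  exact ENNReal.mul_lt_top e.left.volume_toSet_lt_top e.right.volume_toSet_lt_top

theorem OffDiagTerm.memLp_fn (e : OffDiagTerm) : MemLp e.fn 2 volume :=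
  memLp_indicator_const 2 (e.left.measurableSet_toSet.prod e.right.measurableSet_toSet) _
    (Or.inr e.volume_prod_lt_top.ne)

theorem measurePreserving_swap_volume :
    MeasurePreserving (Prod.swap : (ℝ × ℝ) × (ℝ × ℝ) → _) volume volume :=
  Measure.measurePreserving_swap

theorem OffDiagTerm.memLp_fn_swap (e : OffDiagTerm) : MemLp (fun p : (ℝ × ℝ) × (ℝ × ℝ) => e.fn p.swap) 2 volume :=
  e.memLp_fn.comp_measurePreserving measurePreserving_swap_volume

theorem memLp_elemFun (L : List OffDiagTerm) : MemLp (elemFun L) 2 volume :=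
  memLp_list_sum (F := OffDiagTerm.fn) OffDiagTerm.memLp_fn L

theorem integral_indicator_const_mul_indicator_const {α : Type*} [MeasurableSpace α]
    {μ : Measure α} {s t : Set α} (hs : MeasurableSet s) (ht : MeasurableSet t) (a b : ℝ) :
    ∫ x, s.indicator (fun _ => a) x * t.indicator (fun _ => b) x ∂μ =
      a * b * μ.real (s ∩ t) := by
  have : (fun x => s.indicator (fun _ => a) x * t.indicator (fun _ => b) x) =
      (s ∩ t).indicator fun _ => a * b := by
    ext x
    by_cases h1 : x ∈ s <;> by_cases h2 : x ∈ t <;> simp [h1, h2]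
  rw [this, integral_indicator_const _ (hs.inter ht), smul_eq_mul, mul_comm]

theorem OffDiagTerm.integral_fn_mul_fn (e e' : OffDiagTerm) :
    ∫ p, e.fn p * e'.fn p = e.coeff * e'.coeff *
      (volume.real (e.left.toSet ∩ e'.left.toSet) *
        volume.real (e.right.toSet ∩ e'.right.toSet)) := by
  unfold OffDiagTerm.fn
  rw [integral_indicator_const_mul_indicator_const
    (e.left.measurableSet_toSet.prod e.right.measurableSet_toSet)
    (e'.left.measurableSet_toSet.prod e'.right.measurableSet_toSet), Set.prod_inter_prod,
    Measure.volume_eq_prod, measureReal_prod_prod]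

theorem OffDiagTerm.integral_fn_mul_fn_swap (e e' : OffDiagTerm) :
    ∫ p, e.fn p * e'.fn p.swap = e.coeff * e'.coeff *
      (volume.real (e.left.toSet ∩ e'.right.toSet) *
        volume.real (e.right.toSet ∩ e'.left.toSet)) := by
  have : ∀ p : (ℝ × ℝ) × (ℝ × ℝ), e'.fn p.swap =
      (e'.right.toSet ×ˢ e'.left.toSet).indicator (fun _ => e'.coeff) p := fun p => by
    have : p.swap ∈ e'.left.toSet ×ˢ e'.right.toSet ↔ p ∈ e'.right.toSet ×ˢ e'.left.toSet := by
      simp only [Set.mem_prod, Prod.fst_swap, Prod.snd_swap, and_comm]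
    unfold OffDiagTerm.fn
    by_cases h : p ∈ e'.right.toSet ×ˢ e'.left.toSet
    · rw [indicator_of_mem h, indicator_of_mem (this.2 h)]
    · rw [indicator_of_notMem h, indicator_of_notMem (this.not.2 h)]
  simp_rw [this]
  unfold OffDiagTerm.fn
  rw [integral_indicator_const_mul_indicator_const
    (e.left.measurableSet_toSet.prod e.right.measurableSet_toSet)
    (e'.right.measurableSet_toSet.prod e'.left.measurableSet_toSet), Set.prod_inter_prod,
    Measure.volume_eq_prod, measureReal_prod_prod]

/-- The double integral of a single term. -/
def OffDiagTerm.stoch (B : ℝ≥0 × ℝ≥0 → Ω → ℝ) (e : OffDiagTerm) (ω : Ω) : ℝ :=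
  e.coeff * (e.left.incr B ω * e.right.incr B ω)

theorem OffDiagTerm.memLp_stoch (hB : IsBrownianSheet B P) (e : OffDiagTerm) :
    MemLp (e.stoch B) 2 P :=
  (hB.isCentredGaussianSpace.memLp_mul (e.left.incr_mem B) (e.right.incr_mem B)).const_mul _

theorem memLp_elemIntegral (hB : IsBrownianSheet B P) (L : List OffDiagTerm) :
    MemLp (elemIntegral B L) 2 P :=
  memLp_list_sum (F := OffDiagTerm.stoch B) (OffDiagTerm.memLp_stoch hB) L

/-- Isserlis' formula gives three pairings. The one that joins left and right of the same term
contains the area of their intersection, which is empty; the remaining two are the direct and the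
swapped kernel pairing. -/
theorem OffDiagTerm.integral_stoch_mul_stoch (hB : IsBrownianSheet B P) (e e' : OffDiagTerm) :
    ∫ ω, e.stoch B ω * e'.stoch B ω ∂P =
      (∫ p, e.fn p * e'.fn p) + ∫ p, e.fn p * e'.fn p.swap := by
  have h : ∀ ω, e.stoch B ω * e'.stoch B ω = (e.coeff * e'.coeff) *
      ((e.left.incr B ω * e.right.incr B ω) * (e'.left.incr B ω * e'.right.incr B ω)) := fun ω => by
    unfold OffDiagTerm.stoch; ring
  simp_rw [h]
  rw [integral_const_mul, hB.isCentredGaussianSpace.integral_mul_mul (e.left.incr_mem B)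
    (e.right.incr_mem B) (e'.left.incr_mem B) (e'.right.incr_mem B),
    e.integral_fn_mul_fn, e.integral_fn_mul_fn_swap]
  simp only [hB.integral_incr_mul_incr]
  rw [e.disjoint.inter_eq]
  simp only [measureReal_empty]
  ring

theorem integral_elemIntegral_mul_elemIntegral (hB : IsBrownianSheet B P)
    (L L' : List OffDiagTerm) :
    ∫ ω, elemIntegral B L ω * elemIntegral B L' ω ∂P =
      (∫ p, elemFun L p * elemFun L' p) + ∫ p, elemFun L p * elemFun L' p.swap := by
  have h1 := integral_list_sum_mul_list_sum (OffDiagTerm.memLp_stoch hB)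
    (OffDiagTerm.memLp_stoch hB) L L'
  have h2 := integral_list_sum_mul_list_sum OffDiagTerm.memLp_fn OffDiagTerm.memLp_fn L L'
  have h3 := integral_list_sum_mul_list_sum OffDiagTerm.memLp_fn OffDiagTerm.memLp_fn_swap L L'
  simp only [OffDiagTerm.integral_stoch_mul_stoch hB, List.sum_map_add] at h1
  rw [← h2, ← h3] at h1
  exact h1

/-- The term with its coefficient multiplied by `a`. -/
def OffDiagTerm.smul (a : ℝ) (e : OffDiagTerm) : OffDiagTerm := { e with coeff := a * e.coeff }

theorem elemFun_append (L L' : List OffDiagTerm) (p : (ℝ × ℝ) × (ℝ × ℝ)) :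
    elemFun (L ++ L') p = elemFun L p + elemFun L' p := by
  simp [elemFun]

theorem elemFun_map_smul (a : ℝ) (L : List OffDiagTerm) (p : (ℝ × ℝ) × (ℝ × ℝ)) :
    elemFun (L.map (OffDiagTerm.smul a)) p = a * elemFun L p := by
  rw [elemFun, elemFun, List.map_map, ← List.sum_map_mul_left]
  congr 2
  ext e
  by_cases h : p ∈ e.left.toSet ×ˢ e.right.toSet <;> simp [OffDiagTerm.smul, h]

omit [MeasurableSpace Ω] in
theorem elemIntegral_append (L L' : List OffDiagTerm) (ω : Ω) :
    elemIntegral B (L ++ L') ω = elemIntegral B L ω + elemIntegral B L' ω := by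
  simp [elemIntegral]

omit [MeasurableSpace Ω] in
theorem elemIntegral_map_smul (a : ℝ) (L : List OffDiagTerm) (ω : Ω) :
    elemIntegral B (L.map (OffDiagTerm.smul a)) ω = a * elemIntegral B L ω := by
  rw [elemIntegral, elemIntegral, List.map_map, ← List.sum_map_mul_left]
  congr 2
  ext e
  simp only [Function.comp, OffDiagTerm.smul]
  ring

/-- The list of the difference of two elementary functions. -/
def subList (L L' : List OffDiagTerm) : List OffDiagTerm := L ++ L'.map (OffDiagTerm.smul (-1))

theorem elemFun_subList (L L' : List OffDiagTerm) (p : (ℝ × ℝ) × (ℝ × ℝ)) :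
    elemFun (subList L L') p = elemFun L p - elemFun L' p := by
  rw [subList, elemFun_append, elemFun_map_smul]; ring

omit [MeasurableSpace Ω] in
theorem elemIntegral_subList (L L' : List OffDiagTerm) (ω : Ω) :
    elemIntegral B (subList L L') ω = elemIntegral B L ω - elemIntegral B L' ω := by
  rw [subList, elemIntegral_append, elemIntegral_map_smul]; ring

/-! ### Convergence in `L²` -/

section L2

variable {α : Type*} [MeasurableSpace α] {μ : Measure α}

theorem inner_toLp {f g : α → ℝ} (hf : MemLp f 2 μ) (hg : MemLp g 2 μ) :
    inner ℝ (hf.toLp f) (hg.toLp g) = ∫ x, f x * g x ∂μ := by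
  rw [L2.inner_def]
  refine integral_congr_ae ?_
  filter_upwards [hf.coeFn_toLp, hg.coeFn_toLp] with x h1 h2
  rw [h1, h2]
  simp [mul_comm]

theorem norm_toLp_sq {f : α → ℝ} (hf : MemLp f 2 μ) :
    ‖hf.toLp f‖ ^ 2 = ∫ x, f x * f x ∂μ := by
  rw [← inner_toLp hf hf, real_inner_self_eq_norm_sq]

theorem tendsto_toLp_of_tendsto_eLpNorm_sub {f : ℕ → α → ℝ} {g : α → ℝ}
    (hf : ∀ n, MemLp (f n) 2 μ) (hg : MemLp g 2 μ)
    (h : Tendsto (fun n => eLpNorm (fun x => g x - f n x) 2 μ) atTop (𝓝 0)) :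
    Tendsto (fun n => (hf n).toLp (f n)) atTop (𝓝 (hg.toLp g)) := by
  rw [Lp.tendsto_Lp_iff_tendsto_eLpNorm'']
  refine h.congr fun n => ?_
  rw [← eLpNorm_neg]
  congr 1
  ext x
  simp

theorem tendsto_integral_mul_of_tendsto_eLpNorm_sub {f f' : ℕ → α → ℝ} {g g' : α → ℝ}
    (hf : ∀ n, MemLp (f n) 2 μ) (hf' : ∀ n, MemLp (f' n) 2 μ) (hg : MemLp g 2 μ)
    (hg' : MemLp g' 2 μ)
    (h : Tendsto (fun n => eLpNorm (fun x => g x - f n x) 2 μ) atTop (𝓝 0))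
    (h' : Tendsto (fun n => eLpNorm (fun x => g' x - f' n x) 2 μ) atTop (𝓝 0)) :
    Tendsto (fun n => ∫ x, f n x * f' n x ∂μ) atTop (𝓝 (∫ x, g x * g' x ∂μ)) := by
  have := (tendsto_toLp_of_tendsto_eLpNorm_sub hf hg h).inner (𝕜 := ℝ)
    (tendsto_toLp_of_tendsto_eLpNorm_sub hf' hg' h')
  simpa only [inner_toLp] using this

theorem tendsto_eLpNorm_sub_sub {f f' : ℕ → α → ℝ} {g g' : α → ℝ}
    (hf : ∀ n, MemLp (f n) 2 μ) (hf' : ∀ n, MemLp (f' n) 2 μ) (hg : MemLp g 2 μ)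
    (hg' : MemLp g' 2 μ)
    (h : Tendsto (fun n => eLpNorm (fun x => g x - f n x) 2 μ) atTop (𝓝 0))
    (h' : Tendsto (fun n => eLpNorm (fun x => g' x - f' n x) 2 μ) atTop (𝓝 0)) :
    Tendsto (fun n => eLpNorm (fun x => (g x - g' x) - (f n x - f' n x)) 2 μ) atTop (𝓝 0) := by
  refine tendsto_of_tendsto_of_tendsto_of_le_of_le tendsto_const_nhds
    (by simpa using h.add h') (fun _ => zero_le) fun n => ?_
  have e : (fun x => (g x - g' x) - (f n x - f' n x)) =
      (fun x => g x - f n x) - fun x => g' x - f' n x := by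
    ext x; simp only [Pi.sub_apply]; ring
  dsimp only
  rw [e]
  exact eLpNorm_sub_le (hg.sub (hf n)).1 (hg'.sub (hf' n)).1 (by norm_num)

end L2

/-! ### The isometry -/

/-- The second moment of the difference of two double Wiener integrals. -/
theorem IsDoubleWienerIntegral.integral_sub_sq (hB : IsBrownianSheet B P)
    {g g' : (ℝ × ℝ) × (ℝ × ℝ) → ℝ} {X X' : Ω → ℝ} (h : IsDoubleWienerIntegral B P g X)
    (h' : IsDoubleWienerIntegral B P g' X') (hsymm : ∀ p, g p.swap = g p)
    (hsymm' : ∀ p, g' p.swap = g' p) :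
    ∫ ω, (X ω - X' ω) ^ 2 ∂P = 2 * ∫ p, (g p - g' p) * (g p - g' p) := by
  obtain ⟨L, hL, hI⟩ := h.exists_approx
  obtain ⟨L', hL', hI'⟩ := h'.exists_approx
  have hf := tendsto_eLpNorm_sub_sub (fun n => memLp_elemFun (L n)) (fun n => memLp_elemFun (L' n))
    h.memLp_integrand h'.memLp_integrand hL hL'
  have hX := tendsto_eLpNorm_sub_sub (fun n => memLp_elemIntegral hB (L n))
    (fun n => memLp_elemIntegral hB (L' n)) h.memLp h'.memLp hI hI'
  have hg := h.memLp_integrand.sub h'.memLp_integrand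
  simp only [← elemFun_subList, ← elemIntegral_subList] at hf hX
  -- The approximating elementary functions need not be symmetric, but swapping preserves volume and
  -- fixes `g - g'`, so the swapped ones converge to the same limit. Both pairings then tend to `‖g
  -- - g'‖²`, whence the factor `2`.
  have hfs : Tendsto (fun n => eLpNorm (fun p : (ℝ × ℝ) × (ℝ × ℝ) =>
      (g p - g' p) - elemFun (subList (L n) (L' n)) p.swap) 2 volume) atTop (𝓝 0) := by
    refine hf.congr fun n => ?_
    have := eLpNorm_comp_measurePreserving (p := 2)
      (hg.sub (memLp_elemFun (subList (L n) (L' n)))).1 measurePreserving_swap_volume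
    refine this.symm.trans ?_
    congr 1
    ext p
    simp [hsymm, hsymm']
  have m := fun n => memLp_elemFun (subList (L n) (L' n))
  have m' := fun n => (m n).comp_measurePreserving measurePreserving_swap_volume
  have mI := fun n => memLp_elemIntegral hB (subList (L n) (L' n))
  have t1 := tendsto_integral_mul_of_tendsto_eLpNorm_sub mI mI (h.memLp.sub h'.memLp)
    (h.memLp.sub h'.memLp) hX hX
  have t2 := (tendsto_integral_mul_of_tendsto_eLpNorm_sub m m hg hg hf hf).add
    (tendsto_integral_mul_of_tendsto_eLpNorm_sub m m' hg hg hf hfs)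
  simp only [integral_elemIntegral_mul_elemIntegral hB] at t1
  have := tendsto_nhds_unique t1 t2
  simp only [Pi.sub_apply] at this
  simp only [sq]
  rw [this]; ring

/-- Without symmetry the swapped pairing is only bounded, by Cauchy–Schwarz, by the squared norm.
The inequality is all that completeness requires. -/
theorem integral_elemIntegral_mul_self_le (hB : IsBrownianSheet B P) (L : List OffDiagTerm) :
    ∫ ω, elemIntegral B L ω * elemIntegral B L ω ∂P ≤ 2 * ∫ p, elemFun L p * elemFun L p := by
  rw [integral_elemIntegral_mul_elemIntegral hB]
  have m := memLp_elemFun L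
  have m' := m.comp_measurePreserving measurePreserving_swap_volume
  have h1 : ∫ p, (elemFun L ∘ Prod.swap) p * (elemFun L ∘ Prod.swap) p =
      ∫ p, elemFun L p * elemFun L p :=
    measurePreserving_swap_volume.integral_comp MeasurableEquiv.prodComm.measurableEmbedding
      fun p => elemFun L p * elemFun L p
  have h2 := real_inner_le_norm (m.toLp _) (m'.toLp _)
  have h3 : ‖m'.toLp _‖ = ‖m.toLp _‖ := by
    rw [← sq_eq_sq₀ (norm_nonneg _) (norm_nonneg _), norm_toLp_sq, norm_toLp_sq, h1]
  rw [h3, ← sq, norm_toLp_sq, inner_toLp] at h2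
  simp only [Function.comp] at h2
  linarith

/-- Existence of the double Wiener integral of a limit of elementary functions. -/
theorem exists_isDoubleWienerIntegral_of_tendsto (hB : IsBrownianSheet B P)
    {g : (ℝ × ℝ) × (ℝ × ℝ) → ℝ} (hg : MemLp g 2 volume) {L : ℕ → List OffDiagTerm}
    (hL : Tendsto (fun n => eLpNorm (fun p => g p - elemFun (L n) p) 2 volume) atTop (𝓝 0)) :
    ∃ X, IsDoubleWienerIntegral B P g X := by
  have hlim := tendsto_toLp_of_tendsto_eLpNorm_sub (fun n => memLp_elemFun (L n)) hg hL
  have hle : ∀ n m, dist ((memLp_elemIntegral hB (L n)).toLp _)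
      ((memLp_elemIntegral hB (L m)).toLp _) ≤
      2 * dist ((memLp_elemFun (L n)).toLp _) ((memLp_elemFun (L m)).toLp _) := fun n m => by
    rw [dist_eq_norm, dist_eq_norm, ← MemLp.toLp_sub, ← MemLp.toLp_sub]
    -- The squared bound has constant `2`, so `√2` would do; the cruder Lipschitz constant `2`
    -- avoids the root.
    refine le_of_sq_le_sq ?_ (by positivity)
    rw [mul_pow, norm_toLp_sq, norm_toLp_sq]
    have := integral_elemIntegral_mul_self_le hB (subList (L n) (L m))
    simp only [elemIntegral_subList, elemFun_subList] at this
    simp only [Pi.sub_apply]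
    have h0 : 0 ≤ ∫ p, (elemFun (L n) p - elemFun (L m) p) * (elemFun (L n) p - elemFun (L m) p) :=
      integral_nonneg fun p => mul_self_nonneg _
    linarith
  have hc : CauchySeq fun n => (memLp_elemIntegral hB (L n)).toLp _ := by
    rw [Metric.cauchySeq_iff]
    intro ε hε
    obtain ⟨N, hN⟩ := Metric.cauchySeq_iff.1 hlim.cauchySeq (ε / 2) (by positivity)
    exact ⟨N, fun n hn m hm => (hle n m).trans_lt (by linarith [hN n hn m hm])⟩
  obtain ⟨X, hX⟩ := cauchySeq_tendsto_of_complete hc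
  refine ⟨X, hg, Lp.memLp X, L, hL, ?_⟩
  have e : X = (Lp.memLp X).toLp X := (Lp.toLp_coeFn X _).symm
  rw [e, Lp.tendsto_Lp_iff_tendsto_eLpNorm''] at hX
  refine hX.congr fun n => ?_
  rw [← eLpNorm_neg]
  congr 1
  ext x
  simp

/-! ### Density of the elementary functions -/

/-- The subspace of `L²` of classes of elementary functions. -/
noncomputable def elemSubmodule :
    Submodule ℝ (Lp ℝ 2 (volume : Measure ((ℝ × ℝ) × (ℝ × ℝ)))) where
  carrier := {f | ∃ L, f =ᵐ[volume] elemFun L}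
  add_mem' := by
    rintro f f' ⟨L, hL⟩ ⟨L', hL'⟩
    refine ⟨L ++ L', ?_⟩
    filter_upwards [hL, hL', Lp.coeFn_add f f'] with p h1 h2 h3
    rw [h3, Pi.add_apply, h1, h2, elemFun_append]
  zero_mem' := ⟨[], by
    filter_upwards [Lp.coeFn_zero ℝ 2 (volume : Measure ((ℝ × ℝ) × (ℝ × ℝ)))] with p h
    rw [h]; simp [elemFun]⟩
  smul_mem' := by
    rintro a f ⟨L, hL⟩
    refine ⟨L.map (OffDiagTerm.smul a), ?_⟩
    filter_upwards [hL, Lp.coeFn_smul a f] with p h1 h2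
    rw [h2, Pi.smul_apply, h1, elemFun_map_smul, smul_eq_mul]

theorem setIntegral_eq_zero_of_mem_orthogonal
    {h : Lp ℝ 2 (volume : Measure ((ℝ × ℝ) × (ℝ × ℝ)))} (hh : h ∈ elemSubmoduleᗮ) {R R' : Rect}
    (hR : Disjoint R.toSet R'.toSet) : ∫ p in R.toSet ×ˢ R'.toSet, h p = 0 := by
  have hm : MeasurableSet (R.toSet ×ˢ R'.toSet) :=
    R.measurableSet_toSet.prod R'.measurableSet_toSet
  have hL := memLp_elemFun [⟨1, R, R', hR⟩]
  have h0 := (Submodule.mem_orthogonal _ _).1 hh (hL.toLp _) ⟨_, hL.coeFn_toLp⟩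
  have e : h = (Lp.memLp h).toLp h := (Lp.toLp_coeFn h _).symm
  rw [e, inner_toLp] at h0
  rw [← integral_indicator hm, ← h0]
  congr 1
  ext p
  by_cases hp : p ∈ R.toSet ×ˢ R'.toSet <;> simp [elemFun, hp]

/-- Balls of the sup metric are squares. A radius smaller than both coordinates keeps the square
inside the quadrant, where the endpoints of a `Rect` must lie. -/
theorem exists_rect_of_lt {x : ℝ × ℝ} {r : ℝ} (hr : 0 ≤ r) (h1 : r < x.1) (h2 : r < x.2) :
    ∃ R : Rect, R.toSet ⊆ Metric.closedBall x r ∧ Metric.closedBall x r =ᵐ[volume] R.toSet := by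
  refine ⟨⟨(x.1 - r).toNNReal, (x.1 + r).toNNReal, (x.2 - r).toNNReal, (x.2 + r).toNNReal,
    Real.toNNReal_le_toNNReal (by linarith), Real.toNNReal_le_toNNReal (by linarith)⟩, ?_, ?_⟩
  · rw [Rect.toSet, ← closedBall_prod_same, Real.closedBall_eq_Icc, Real.closedBall_eq_Icc,
      Real.coe_toNNReal _ (by linarith), Real.coe_toNNReal _ (by linarith),
      Real.coe_toNNReal _ (by linarith), Real.coe_toNNReal _ (by linarith)]
    exact Set.prod_mono Ioc_subset_Icc_self Ioc_subset_Icc_self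
  · rw [Rect.toSet, ← closedBall_prod_same, Real.closedBall_eq_Icc, Real.closedBall_eq_Icc,
      Real.coe_toNNReal _ (by linarith), Real.coe_toNNReal _ (by linarith),
      Real.coe_toNNReal _ (by linarith), Real.coe_toNNReal _ (by linarith)]
    exact Measure.set_prod_ae_eq Ioc_ae_eq_Icc.symm Ioc_ae_eq_Icc.symm

/-- The excluded set is a proper linear subspace, hence null, and it contains the diagonal. -/
theorem ae_fst_fst_ne_snd_fst : ∀ᵐ p : (ℝ × ℝ) × (ℝ × ℝ), p.1.1 ≠ p.2.1 := by
  let l : (ℝ × ℝ) × (ℝ × ℝ) →ₗ[ℝ] ℝ :=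
    LinearMap.fst ℝ ℝ ℝ ∘ₗ LinearMap.fst ℝ (ℝ × ℝ) (ℝ × ℝ) -
      LinearMap.fst ℝ ℝ ℝ ∘ₗ LinearMap.snd ℝ (ℝ × ℝ) (ℝ × ℝ)
  have hne : LinearMap.ker l ≠ ⊤ := fun h => by
    have : ((1, 0), (0, 0)) ∈ LinearMap.ker l := h ▸ Submodule.mem_top
    simp [l] at this
  have : (volume : Measure (ℝ × ℝ)).IsAddHaarMeasure := Measure.prod.instIsAddHaarMeasure _ _
  have : (volume : Measure ((ℝ × ℝ) × (ℝ × ℝ))).IsAddHaarMeasure :=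
    Measure.prod.instIsAddHaarMeasure _ _
  have h0 := Measure.addHaar_submodule volume _ hne
  refine measure_mono_null (fun p hp => ?_) h0
  simp only [mem_compl_iff, mem_ofPred_eq, not_not] at hp
  simp [l, hp]

/-- Lebesgue differentiation: almost everywhere `h` is the limit of its averages over small
sup-metric balls. Such a ball is a product of two squares, and off the diagonal these become
disjoint, so orthogonality makes the averages vanish. -/
theorem ae_eq_zero_of_mem_orthogonal
    {h : Lp ℝ 2 (volume : Measure ((ℝ × ℝ) × (ℝ × ℝ)))} (hh : h ∈ elemSubmoduleᗮ) :
    ∀ᵐ p, 0 < p.1.1 → 0 < p.1.2 → 0 < p.2.1 → 0 < p.2.2 → h p = 0 := by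
  have hloc : LocallyIntegrable h volume := (Lp.memLp h).locallyIntegrable (by norm_num)
  filter_upwards [IsUnifLocDoublingMeasure.ae_tendsto_average (volume) hloc 1,
    ae_fst_fst_ne_snd_fst] with p hp hne h1 h2 h3 h4
  have hlim := hp (l := 𝓝[>] (0 : ℝ)) (fun _ => p) id tendsto_id (by
    filter_upwards [self_mem_nhdsWithin] with r hr
    simpa using le_of_lt hr)
  refine tendsto_nhds_unique hlim (tendsto_const_nhds.congr' ?_)
  -- The coordinates bound the radius so that both squares lie in the quadrant; half the distance
  -- makes the squares disjoint.
  have hδ : 0 < min (min (min p.1.1 p.1.2) (min p.2.1 p.2.2)) (dist p.1 p.2 / 2) := by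
    have : 0 < dist p.1 p.2 := dist_pos.2 fun h => hne (by rw [h])
    positivity
  filter_upwards [Ioo_mem_nhdsGT hδ] with r hr
  obtain ⟨hr0, hr1⟩ := hr
  simp only [lt_min_iff] at hr1
  obtain ⟨⟨⟨k1, k2⟩, k3, k4⟩, k5⟩ := hr1
  obtain ⟨R, hR, hR'⟩ := exists_rect_of_lt hr0.le k1 k2
  obtain ⟨S, hS, hS'⟩ := exists_rect_of_lt hr0.le k3 k4
  have hd : Disjoint R.toSet S.toSet :=
    (Metric.closedBall_disjoint_closedBall (by linarith)).mono hR hS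
  have he : Metric.closedBall p r =ᵐ[volume] R.toSet ×ˢ S.toSet := by
    rw [← closedBall_prod_same]
    exact Measure.set_prod_ae_eq hR' hS'
  rw [id, setAverage_eq, setIntegral_congr_set he, setIntegral_eq_zero_of_mem_orthogonal hh hd,
    smul_zero]

/-- Every square integrable function on the product of two quadrants is a limit of elementary
functions. -/
theorem exists_tendsto_elemFun {g : (ℝ × ℝ) × (ℝ × ℝ) → ℝ} (hg : MemLp g 2 volume)
    (h0 : ∀ᵐ p, ¬ (0 < p.1.1 ∧ 0 < p.1.2 ∧ 0 < p.2.1 ∧ 0 < p.2.2) → g p = 0) :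
    ∃ L : ℕ → List OffDiagTerm,
      Tendsto (fun n => eLpNorm (fun p => g p - elemFun (L n) p) 2 volume) atTop (𝓝 0) := by
  -- The closure of a subspace is its double orthogonal complement. A vector orthogonal to all
  -- elementary functions vanishes on the open quadrants and `g` vanishes off them, so their product
  -- is zero almost everywhere.
  have hmem : hg.toLp g ∈ elemSubmoduleᗮᗮ := by
    rw [Submodule.mem_orthogonal]
    intro h hh
    have e : h = (Lp.memLp h).toLp h := (Lp.toLp_coeFn h _).symm
    rw [e, inner_toLp]
    refine integral_eq_zero_of_ae ?_
    filter_upwards [ae_eq_zero_of_mem_orthogonal hh, h0] with p hp hp0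
    by_cases hq : 0 < p.1.1 ∧ 0 < p.1.2 ∧ 0 < p.2.1 ∧ 0 < p.2.2
    · simp [hp hq.1 hq.2.1 hq.2.2.1 hq.2.2.2]
    · simp [hp0 hq]
  rw [Submodule.orthogonal_orthogonal_eq_closure] at hmem
  obtain ⟨f, hf, hlim⟩ := mem_closure_iff_seq_limit.1 hmem
  choose L hL using hf
  refine ⟨L, ?_⟩
  rw [Lp.tendsto_Lp_iff_tendsto_eLpNorm'] at hlim
  refine hlim.congr fun n => ?_
  rw [← eLpNorm_neg]
  refine eLpNorm_congr_ae ?_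
  filter_upwards [hL n, hg.coeFn_toLp] with p h1 h2
  simp [h1, h2]

theorem isDoubleWienerIntegral_doubleWienerIntegral {Ω : Type*} [MeasurableSpace Ω]
    {P : Measure Ω} {B : ℝ≥0 × ℝ≥0 → Ω → ℝ} (hB : IsBrownianSheet B P)
    {g : (ℝ × ℝ) × (ℝ × ℝ) → ℝ} (hg : MemLp g 2 volume)
    (h0 : ∀ᵐ p, ¬ (0 < p.1.1 ∧ 0 < p.1.2 ∧ 0 < p.2.1 ∧ 0 < p.2.2) → g p = 0) :
    IsDoubleWienerIntegral B P g (doubleWienerIntegral B P g) := by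
  obtain ⟨L, hL⟩ := exists_tendsto_elemFun hg h0
  have h := exists_isDoubleWienerIntegral_of_tendsto hB hg hL
  rw [doubleWienerIntegral, dif_pos h]
  exact h.choose_spec

/-! ### Truncated powers -/

/-- The power `x ^ s` of a positive number, and `0` on `(-∞, 0]`. -/
noncomputable def posPow (s x : ℝ) : ℝ≥0∞ := (Ioi 0).indicator (fun x => ENNReal.ofReal (x ^ s)) x

@[fun_prop]
theorem measurable_posPow (s : ℝ) : Measurable (posPow s) :=
  Measurable.indicator (by fun_prop) measurableSet_Ioi

theorem posPow_of_pos {x : ℝ} (hx : 0 < x) (s : ℝ) : posPow s x = ENNReal.ofReal (x ^ s) :=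
  indicator_of_mem (s := Ioi 0) hx _

theorem posPow_of_nonpos {x : ℝ} (hx : x ≤ 0) (s : ℝ) : posPow s x = 0 :=
  indicator_of_notMem (s := Ioi 0) (not_lt.2 hx) _

theorem posPow_ne_top (s x : ℝ) : posPow s x ≠ ∞ := by
  rcases lt_or_ge 0 x with h | h
  · rw [posPow_of_pos h]; exact ENNReal.ofReal_ne_top
  · rw [posPow_of_nonpos h]; exact ENNReal.zero_ne_top

theorem toReal_posPow {x : ℝ} (hx : 0 < x) (s : ℝ) : (posPow s x).toReal = x ^ s := by
  rw [posPow_of_pos hx, ENNReal.toReal_ofReal (by positivity)]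

theorem posPow_mul_posPow (s s' x : ℝ) : posPow s x * posPow s' x = posPow (s + s') x := by
  rcases lt_or_ge 0 x with h | h
  · rw [posPow_of_pos h, posPow_of_pos h, posPow_of_pos h, ← ENNReal.ofReal_mul (by positivity),
      Real.rpow_add h]
  · simp [posPow_of_nonpos h]

theorem posPow_mul_left {c : ℝ} (hc : 0 < c) (s x : ℝ) :
    posPow s (c * x) = posPow s c * posPow s x := by
  rcases lt_or_ge 0 x with h | h
  · rw [posPow_of_pos h, posPow_of_pos hc, posPow_of_pos (by positivity),
      ← ENNReal.ofReal_mul (by positivity), Real.mul_rpow hc.le h.le]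
  · rw [posPow_of_nonpos h, posPow_of_nonpos (mul_nonpos_of_nonneg_of_nonpos hc.le h), mul_zero]

/-- Exponent `0` gives the indicator of `(0, ∞)`, not the constant `1`; a cut-off `x < t` is
therefore written `posPow 0 (t - x)`. -/
theorem posPow_zero_of_pos {x : ℝ} (hx : 0 < x) : posPow 0 x = 1 := by
  simp [posPow_of_pos hx]

/-- Disjoint supports; this removes the cross terms between the two halves of a symmetric kernel. -/
theorem posPow_mul_posPow_neg (s s' x : ℝ) : posPow s x * posPow s' (-x) = 0 := by
  rcases lt_or_ge 0 x with h | h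
  · rw [posPow_of_nonpos (x := -x) (by linarith), mul_zero]
  · rw [posPow_of_nonpos h, zero_mul]

theorem lintegral_eq_mul_lintegral_comp_mul {f : ℝ → ℝ≥0∞} (hf : Measurable f) {c : ℝ}
    (hc : 0 < c) : ∫⁻ x, f x = ENNReal.ofReal c * ∫⁻ x, f (c * x) := by
  conv_lhs => rw [← Real.smul_map_volume_mul_left hc.ne']
  rw [lintegral_smul_measure, lintegral_map hf (by fun_prop), abs_of_pos hc, smul_eq_mul]

/-! ### Beta integrals -/

theorem lintegral_posPow_mul_posPow_one_sub {p q : ℝ} (hp : 0 < p) (hq : 0 < q) :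
    ∫⁻ r, posPow (p - 1) r * posPow (q - 1) (1 - r) = ENNReal.ofReal (beta p q) := by
  have hb := beta_pos hp hq
  have h : ∀ r, posPow (p - 1) r * posPow (q - 1) (1 - r) =
      ENNReal.ofReal (beta p q) * betaPDF p q r := fun r => by
    by_cases hr : 0 < r ∧ r < 1
    · have h1 : 0 < 1 - r := by linarith [hr.2]
      have h0 := hr.1
      rw [posPow_of_pos h0, posPow_of_pos h1, betaPDF_of_pos_lt_one hr.1 hr.2,
        ← ENNReal.ofReal_mul (by positivity), ← ENNReal.ofReal_mul hb.le]
      congr 1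
      field_simp
    · rw [betaPDF_eq, if_neg hr, ENNReal.ofReal_zero, mul_zero]
      rcases not_and_or.1 hr with h | h
      · rw [posPow_of_nonpos (not_lt.1 h), zero_mul]
      · rw [posPow_of_nonpos (x := 1 - r) (by linarith), mul_zero]
  simp_rw [h]
  rw [lintegral_const_mul' _ _ ENNReal.ofReal_ne_top, lintegral_betaPDF_eq_one hp hq, mul_one]

/-- The dilation `r ↦ y r` reduces to the total mass of the Beta density. -/
theorem lintegral_posPow_mul_posPow_sub {p q : ℝ} (hp : 0 < p) (hq : 0 < q) (y : ℝ) :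
    ∫⁻ r, posPow (p - 1) r * posPow (q - 1) (y - r) =
      ENNReal.ofReal (beta p q) * posPow (p + q - 1) y := by
  rcases lt_or_ge 0 y with hy | hy
  · rw [lintegral_eq_mul_lintegral_comp_mul (by fun_prop) hy]
    have h : ∀ r, posPow (p - 1) (y * r) * posPow (q - 1) (y - y * r) =
        posPow (p - 1 + (q - 1)) y * (posPow (p - 1) r * posPow (q - 1) (1 - r)) := fun r => by
      rw [← posPow_mul_posPow, show y - y * r = y * (1 - r) by ring, posPow_mul_left hy,
        posPow_mul_left hy]
      ring
    simp_rw [h]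
    rw [lintegral_const_mul' _ _ (posPow_ne_top _ _), lintegral_posPow_mul_posPow_one_sub hp hq,
      ← mul_assoc, mul_comm (ENNReal.ofReal (beta p q))]
    congr 1
    rw [show ENNReal.ofReal y = posPow 1 y by simp [posPow_of_pos hy], posPow_mul_posPow]
    congr 1; ring
  · rw [posPow_of_nonpos hy, mul_zero]
    refine (lintegral_congr fun r => ?_).trans lintegral_zero
    rcases lt_or_ge 0 r with hr | hr
    · rw [posPow_of_nonpos (x := y - r) (by linarith), mul_zero]
    · rw [posPow_of_nonpos hr, zero_mul]

theorem beta_comm (p q : ℝ) : beta p q = beta q p := by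
  rw [beta, beta, mul_comm, add_comm]

theorem beta_one_right {p : ℝ} (hp : 0 < p) : beta p 1 = 1 / p := by
  have := Real.Gamma_pos_of_pos hp
  rw [beta, Real.Gamma_one, Real.Gamma_add_one hp.ne', mul_one]
  field_simp

theorem lintegral_posPow_mul_indicator {p : ℝ} (hp : 0 < p) (t : ℝ) :
    ∫⁻ r, posPow (p - 1) r * posPow 0 (t - r) = ENNReal.ofReal (1 / p) * posPow p t := by
  have := lintegral_posPow_mul_posPow_sub hp one_pos t
  rwa [beta_one_right hp, sub_self, add_sub_cancel_right] at this

/-- The Möbius map `v(y) = y (x' - x) / (x (x' - y))` takes `(0, x)` onto `(0, 1)`, with `1 - v = x'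
(x - y) / (x (x' - y))` and `dv` proportional to `(x' - y)⁻² dy`. Since the exponents `-a`, `a/2 -
1`, `a/2 - 1` add up to `-2`, the powers of `x' - y` match exactly and a Beta integral remains. -/
theorem lintegral_kernel_mul_kernel_of_lt {a x x' : ℝ} (ha : 0 < a) (ha1 : a < 1) (hx : 0 < x)
    (hxx' : x < x') :
    ∫⁻ y, posPow (-a) y * posPow (a / 2 - 1) (x - y) * posPow (a / 2 - 1) (x' - y) =
      ENNReal.ofReal (beta (1 - a) (a / 2)) * (posPow (-(a / 2)) x * posPow (-(a / 2)) x' *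
        posPow (a - 1) (x' - x)) := by
  have hx' : 0 < x' := hx.trans hxx'
  have hd : 0 < x' - x := sub_pos.2 hxx'
  set v : ℝ → ℝ := fun y => y * (x' - x) / (x * (x' - y)) with hv
  set v' : ℝ → ℝ := fun y => x' * (x' - x) / (x * (x' - y) ^ 2) with hv'
  have hder : ∀ y ∈ Ioo 0 x, HasDerivWithinAt v (v' y) (Ioo 0 x) y := fun y hy => by
    have h1 : x' - y ≠ 0 := by linarith [hy.2]
    have := (((hasDerivAt_id y).mul_const (x' - x)).div
      (((hasDerivAt_id y).const_sub x').const_mul x) (mul_ne_zero hx.ne' h1)).hasDerivWithinAt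
      (s := Ioo 0 x)
    convert! this using 1
    simp only [hv', id]
    field_simp
    ring
  have hinj : InjOn v (Ioo 0 x) := fun y hy z hz h => by
    have h1 : 0 < x' - y := by linarith [hy.2]
    have h2 : 0 < x' - z := by linarith [hz.2]
    simp only [hv] at h
    rw [div_eq_div_iff (by positivity) (by positivity)] at h
    have : (y - z) * (x * x' * (x' - x)) = 0 := by linear_combination h
    have hpos : x * x' * (x' - x) ≠ 0 := by positivity
    exact sub_eq_zero.1 ((mul_eq_zero.1 this).resolve_right hpos)
  have himg : v '' Ioo 0 x = Ioo 0 1 := by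
    ext z
    constructor
    · rintro ⟨y, hy, rfl⟩
      have h1 : 0 < x' - y := by linarith [hy.2]
      refine ⟨div_pos (mul_pos hy.1 hd) (by positivity), (div_lt_one (by positivity)).2 ?_⟩
      nlinarith [hy.2]
    · rintro ⟨h0, h1⟩
      have hden : 0 < x' - x + z * x := by positivity
      -- The solution `y` of the equation `v y = z`, which is linear in `y`.
      refine ⟨z * x * x' / (x' - x + z * x), ⟨by positivity, ?_⟩, ?_⟩
      · rw [div_lt_iff₀ hden]
        nlinarith [mul_pos (mul_pos hx hd) (sub_pos.2 h1)]
      · have : x' - z * x * x' / (x' - x + z * x) = x' * (x' - x) / (x' - x + z * x) := by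
          field_simp; ring
        simp only [hv]
        rw [this]
        field_simp
  set C : ℝ := (x' - x) ^ (1 - a) * x ^ (a / 2) * x' ^ (a / 2) with hC
  have hpt : ∀ y ∈ Ioo 0 x, ENNReal.ofReal |v' y| *
      (posPow (-a) (v y) * posPow (a / 2 - 1) (1 - v y)) = ENNReal.ofReal C *
      (posPow (-a) y * posPow (a / 2 - 1) (x - y) * posPow (a / 2 - 1) (x' - y)) := fun y hy => by
    have h1 : 0 < x' - y := by linarith [hy.2]
    have h2 : 0 < x - y := by linarith [hy.2]
    have hy0 := hy.1
    have e1 : 1 - v y = x' * (x - y) / (x * (x' - y)) := by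
      simp only [hv]; field_simp; ring
    have hvy : 0 < v y := by simp only [hv]; positivity
    have hv'y : 0 < v' y := by simp only [hv']; positivity
    rw [e1, posPow_of_pos hvy, posPow_of_pos (by positivity), posPow_of_pos hy0, posPow_of_pos h1,
      posPow_of_pos h2, abs_of_pos hv'y, ← ENNReal.ofReal_mul (by positivity),
      ← ENNReal.ofReal_mul (by positivity), ← ENNReal.ofReal_mul (by positivity),
      ← ENNReal.ofReal_mul (by positivity), ← ENNReal.ofReal_mul (by positivity)]
    congr 1
    simp only [hv, hv', hC]
    -- The claim is an identity between monomials with real exponents in positive quantities.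
    -- Writing each as an exponential turns it into a linear identity of exponents.
    have hex : ∀ {z : ℝ}, 0 < z → ∃ A, z = Real.exp A := fun {z} hz =>
      ⟨Real.log z, (Real.exp_log hz).symm⟩
    obtain ⟨A, hA⟩ := hex hy0
    obtain ⟨D, hD⟩ := hex hd
    obtain ⟨X, hX⟩ := hex hx
    obtain ⟨X', hX'⟩ := hex hx'
    obtain ⟨E, hE⟩ := hex h1
    obtain ⟨F, hF⟩ := hex h2
    rw [hE, hF, hD, hA, hX, hX']
    simp only [← Real.exp_nat_mul, ← Real.exp_add, ← Real.exp_sub, ← Real.exp_mul]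
    congr 1
    push_cast
    ring
  have hcv := lintegral_image_eq_lintegral_abs_deriv_mul measurableSet_Ioo hder hinj
    fun z => posPow (-a) z * posPow (a / 2 - 1) (1 - z)
  rw [himg, setLIntegral_congr_fun measurableSet_Ioo hpt,
    lintegral_const_mul' _ _ ENNReal.ofReal_ne_top,
    setLIntegral_eq_of_support_subset, setLIntegral_eq_of_support_subset] at hcv
  · have hb := lintegral_posPow_mul_posPow_one_sub (p := 1 - a) (q := a / 2) (by linarith)
      (by linarith)
    rw [show 1 - a - 1 = -a by ring, hcv] at hb
    have hCi : posPow (-(a / 2)) x * posPow (-(a / 2)) x' * posPow (a - 1) (x' - x) *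
        ENNReal.ofReal C = 1 := by
      rw [posPow_of_pos hx, posPow_of_pos hx', posPow_of_pos hd,
        ← ENNReal.ofReal_mul (by positivity), ← ENNReal.ofReal_mul (by positivity),
        ← ENNReal.ofReal_mul (by positivity), ENNReal.ofReal_eq_one, hC]
      calc _ = (x ^ (-(a / 2)) * x ^ (a / 2)) * (x' ^ (-(a / 2)) * x' ^ (a / 2)) *
            ((x' - x) ^ (a - 1) * (x' - x) ^ (1 - a)) := by ring
        _ = 1 := by
          rw [← Real.rpow_add hx, ← Real.rpow_add hx', ← Real.rpow_add hd]
          simp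
    rw [← hb, mul_comm (ENNReal.ofReal C * _), ← mul_assoc, hCi, one_mul]
  · refine Function.support_subset_iff'.2 fun y hy => ?_
    rcases lt_or_ge 0 y with h | h
    · rw [posPow_of_nonpos (x := x - y) (not_lt.1 fun h' => hy ⟨h, by linarith⟩), mul_zero, zero_mul]
    · rw [posPow_of_nonpos h, zero_mul, zero_mul]
  · refine Function.support_subset_iff'.2 fun y hy => ?_
    rcases lt_or_ge 0 y with h | h
    · rw [posPow_of_nonpos (x := 1 - y) (not_lt.1 fun h' => hy ⟨h, by linarith⟩), mul_zero]
    · rw [posPow_of_nonpos h, zero_mul]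

theorem lintegral_kernel_mul_kernel {a x x' : ℝ} (ha : 0 < a) (ha1 : a < 1) (hne : x ≠ x') :
    ∫⁻ y, posPow (-a) y * posPow (a / 2 - 1) (x - y) * posPow (a / 2 - 1) (x' - y) =
      ENNReal.ofReal (beta (1 - a) (a / 2)) * (posPow (-(a / 2)) x * posPow (-(a / 2)) x' *
        (posPow (a - 1) (x - x') + posPow (a - 1) (x' - x))) := by
  have key : ∀ {x x' : ℝ}, x < x' →
      ∫⁻ y, posPow (-a) y * posPow (a / 2 - 1) (x - y) * posPow (a / 2 - 1) (x' - y) =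
        ENNReal.ofReal (beta (1 - a) (a / 2)) * (posPow (-(a / 2)) x * posPow (-(a / 2)) x' *
          (posPow (a - 1) (x - x') + posPow (a - 1) (x' - x))) := fun {x x'} h => by
    rw [posPow_of_nonpos (x := x - x') (by linarith), zero_add]
    rcases lt_or_ge 0 x with hx | hx
    · exact lintegral_kernel_mul_kernel_of_lt ha ha1 hx h
    · rw [posPow_of_nonpos hx, zero_mul, zero_mul, mul_zero]
      refine (lintegral_congr fun y => ?_).trans lintegral_zero
      rcases lt_or_ge 0 y with hy | hy
      · rw [posPow_of_nonpos (x := x - y) (by linarith), mul_zero, zero_mul]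
      · rw [posPow_of_nonpos hy, zero_mul, zero_mul]
  rcases lt_or_gt_of_ne hne with h | h
  · exact key h
  · rw [add_comm (posPow (a - 1) (x - x')), mul_comm (posPow (-(a / 2)) x), ← key h]
    exact lintegral_congr fun y => by ring

/-! ### Tonelli computations -/

theorem lintegral_lintegral_sq {f g : ℝ → ℝ≥0∞} (hf : Measurable f) (hg : Measurable g) :
    ∫⁻ y₁, ∫⁻ y₂, (f y₁ * f y₂) * (g y₁ * g y₂) = (∫⁻ y, f y * g y) ^ 2 := by
  have h : ∀ y₁ y₂, (f y₁ * f y₂) * (g y₁ * g y₂) = (f y₁ * g y₁) * (f y₂ * g y₂) :=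
    fun y₁ y₂ => by ring
  simp_rw [h]
  have h2 : ∀ y₁, ∫⁻ y₂, (f y₁ * g y₁) * (f y₂ * g y₂) = (f y₁ * g y₁) * ∫⁻ y, f y * g y :=
    fun y₁ => lintegral_const_mul _ (hf.mul hg)
  simp_rw [h2]
  exact (lintegral_mul_const _ (hf.mul hg)).trans (sq _).symm

/-- For a kernel that is a mixture over `x` of rank-one kernels, Tonelli moves the mixing variable
outermost, so that only rank-one kernels have to be paired with `G`. -/
theorem lintegral_lintegral_mixture {w : ℝ → ℝ≥0∞} {k : ℝ → ℝ → ℝ≥0∞} {G : ℝ → ℝ → ℝ≥0∞}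
    (hw : Measurable w) (hk : Measurable fun p : ℝ × ℝ => k p.1 p.2)
    (hG : Measurable fun p : ℝ × ℝ => G p.1 p.2) :
    ∫⁻ y₁, ∫⁻ y₂, (∫⁻ x, w x * (k x y₁ * k x y₂)) * G y₁ y₂ =
      ∫⁻ x, w x * ∫⁻ y₁, ∫⁻ y₂, (k x y₁ * k x y₂) * G y₁ y₂ := by
  have hF : Measurable fun q : ℝ × ℝ × ℝ =>
      w q.1 * ((k q.1 q.2.1 * k q.1 q.2.2) * G q.2.1 q.2.2) := by
    have h1 : Measurable fun q : ℝ × ℝ × ℝ => k q.1 q.2.1 :=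
      hk.comp (measurable_fst.prodMk measurable_snd.fst)
    have h2 : Measurable fun q : ℝ × ℝ × ℝ => k q.1 q.2.2 :=
      hk.comp (measurable_fst.prodMk measurable_snd.snd)
    exact (hw.comp measurable_fst).mul ((h1.mul h2).mul (hG.comp measurable_snd))
  have hkx : ∀ y, Measurable fun x => k x y := fun y =>
    hk.comp (measurable_id.prodMk measurable_const)
  have hky : ∀ x, Measurable fun y => k x y := fun x =>
    hk.comp (measurable_const.prodMk measurable_id)
  calc _ = ∫⁻ y₁, ∫⁻ y₂, ∫⁻ x, w x * ((k x y₁ * k x y₂) * G y₁ y₂) := by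
        refine lintegral_congr fun y₁ => lintegral_congr fun y₂ => ?_
        refine (lintegral_mul_const _ (hw.mul ((hkx y₁).mul (hkx y₂)))).symm.trans ?_
        exact lintegral_congr fun x => mul_assoc _ _ _
    _ = ∫⁻ y₁, ∫⁻ x, ∫⁻ y₂, w x * ((k x y₁ * k x y₂) * G y₁ y₂) := by
        refine lintegral_congr fun y₁ => lintegral_lintegral_swap ?_
        exact (hF.comp (measurable_snd.prodMk (measurable_const.prodMk measurable_fst))).aemeasurable
    _ = ∫⁻ x, ∫⁻ y₁, ∫⁻ y₂, w x * ((k x y₁ * k x y₂) * G y₁ y₂) := by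
        refine lintegral_lintegral_swap ?_
        refine Measurable.aemeasurable ?_
        exact Measurable.lintegral_prod_right' (f := fun r : (ℝ × ℝ) × ℝ =>
          w r.1.2 * ((k r.1.2 r.1.1 * k r.1.2 r.2) * G r.1.1 r.2))
          (hF.comp (measurable_fst.snd.prodMk (measurable_fst.fst.prodMk measurable_snd)))
    _ = _ := by
        refine lintegral_congr fun x => ?_
        have hm : Measurable fun p : ℝ × ℝ => (k x p.1 * k x p.2) * G p.1 p.2 :=
          (((hky x).comp measurable_fst).mul ((hky x).comp measurable_snd)).mul hG
        rw [← lintegral_const_mul _ hm.lintegral_prod_right']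
        refine lintegral_congr fun y₁ => ?_
        rw [lintegral_const_mul]
        exact hm.comp (measurable_const.prodMk measurable_id)

/-- Exchanging the variables shows that the two halves contribute equally; pairings with a symmetric
kernel thus reduce to the triangle `y < x`. -/
theorem lintegral_lintegral_symm_add {S G : ℝ → ℝ → ℝ≥0∞}
    (hS : Measurable fun p : ℝ × ℝ => S p.1 p.2) (hG : Measurable fun p : ℝ × ℝ => G p.1 p.2)
    (hsymm : ∀ x y, G x y = G y x) :
    ∫⁻ x, ∫⁻ y, (S x y + S y x) * G x y = 2 * ∫⁻ x, ∫⁻ y, S x y * G x y := by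
  have hSG := hS.mul hG
  have hSG' : Measurable fun p : ℝ × ℝ => S p.2 p.1 * G p.1 p.2 :=
    (hS.comp measurable_swap).mul hG
  calc _ = ∫⁻ x, (∫⁻ y, S x y * G x y) + ∫⁻ y, S y x * G x y := by
        refine lintegral_congr fun x => ?_
        refine Eq.trans ?_ (lintegral_add_left
          (hSG.comp (measurable_const.prodMk measurable_id : Measurable fun y => (x, y))) _)
        exact lintegral_congr fun y => add_mul _ _ _
    _ = (∫⁻ x, ∫⁻ y, S x y * G x y) + ∫⁻ x, ∫⁻ y, S y x * G x y :=
        lintegral_add_left hSG.lintegral_prod_right' _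
    _ = (∫⁻ x, ∫⁻ y, S x y * G x y) + ∫⁻ y, ∫⁻ x, S y x * G x y := by
        congr 1
        exact lintegral_lintegral_swap hSG'.aemeasurable
    _ = _ := by
        simp_rw [fun y x => hsymm x y]
        rw [two_mul]

/-! ### The kernels as `[0, ∞]`-valued functions -/

/-- `∂ₓK^{H'}(x, y) / c_{H'}` with `H' = (a + 1) / 2`. -/
noncomputable def derivKernel (a x y : ℝ) : ℝ≥0∞ :=
  posPow (a / 2) x * posPow (-(a / 2)) y * posPow (a / 2 - 1) (x - y)

/-- `Q_a(t, y₁, y₂)` up to a constant. -/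
noncomputable def rosenblattL (a t y₁ y₂ : ℝ) : ℝ≥0∞ :=
  ∫⁻ x, posPow 0 (t - x) * (derivKernel a x y₁ * derivKernel a x y₂)

/-- `(y₁ y₂)^{-a/2}` on `(0, t)²`. -/
noncomputable def productL (a t y₁ y₂ : ℝ) : ℝ≥0∞ :=
  (posPow 0 (t - y₁) * posPow (-(a / 2)) y₁) * (posPow 0 (t - y₂) * posPow (-(a / 2)) y₂)

/-- The half of the singular kernel that lives on `y₂ < y₁`. -/
noncomputable def halfSingularL (a t y₁ y₂ : ℝ) : ℝ≥0∞ :=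
  posPow 0 (t - y₁) * posPow (a / 2) y₁ * posPow (-(a / 2)) y₂ * posPow (a - 1) (y₁ - y₂)

/-- The singular kernel on `(0, t)²`. -/
noncomputable def singularL (a t y₁ y₂ : ℝ) : ℝ≥0∞ :=
  halfSingularL a t y₁ y₂ + halfSingularL a t y₂ y₁

/-- The double integral in `C₂`, over the triangle of side `x`. -/
noncomputable def triangleL (a x : ℝ) : ℝ≥0∞ :=
  ∫⁻ s, ∫⁻ r, posPow 0 s * (posPow (-a) r * posPow (a / 2 - 1) (x - s) *
    posPow (a / 2 - 1) (x - r) * posPow (a - 1) (s - r))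

theorem measurable_derivKernel (a : ℝ) :
    Measurable fun p : ℝ × ℝ => derivKernel a p.1 p.2 := by
  unfold derivKernel; fun_prop

theorem measurable_derivKernel_right (a x : ℝ) : Measurable (derivKernel a x) := by
  unfold derivKernel; fun_prop

theorem measurable_rosenblattL (a t : ℝ) :
    Measurable fun p : ℝ × ℝ => rosenblattL a t p.1 p.2 := by
  unfold rosenblattL derivKernel
  exact Measurable.lintegral_prod_right' (f := fun r : (ℝ × ℝ) × ℝ => posPow 0 (t - r.2) *
    ((posPow (a / 2) r.2 * posPow (-(a / 2)) r.1.1 * posPow (a / 2 - 1) (r.2 - r.1.1)) *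
      (posPow (a / 2) r.2 * posPow (-(a / 2)) r.1.2 * posPow (a / 2 - 1) (r.2 - r.1.2))))
    (by fun_prop)

theorem measurable_productL (a t : ℝ) : Measurable fun p : ℝ × ℝ => productL a t p.1 p.2 := by
  unfold productL; fun_prop

theorem measurable_halfSingularL (a t : ℝ) :
    Measurable fun p : ℝ × ℝ => halfSingularL a t p.1 p.2 := by
  unfold halfSingularL; fun_prop

theorem measurable_singularL (a t : ℝ) : Measurable fun p : ℝ × ℝ => singularL a t p.1 p.2 :=
  (measurable_halfSingularL a t).add ((measurable_halfSingularL a t).comp measurable_swap)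

theorem singularL_comm (a t y₁ y₂ : ℝ) : singularL a t y₁ y₂ = singularL a t y₂ y₁ :=
  add_comm _ _

theorem productL_comm (a t y₁ y₂ : ℝ) : productL a t y₁ y₂ = productL a t y₂ y₁ :=
  mul_comm _ _

/-- Absorption of the cut-off of the smaller variable. -/
theorem posPow_mul_posPow_absorb (t x y s : ℝ) :
    posPow 0 (t - x) * posPow s (x - y) * posPow 0 (t - y) =
      posPow 0 (t - x) * posPow s (x - y) := by
  rcases lt_or_ge 0 (t - x) with h | h
  · rcases lt_or_ge 0 (x - y) with h' | h'
    · rw [posPow_zero_of_pos (x := t - y) (by linarith), mul_one]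
    · rw [posPow_of_nonpos h', mul_zero, zero_mul]
  · rw [posPow_of_nonpos h, zero_mul, zero_mul]

theorem posPow_mul_posPow_absorb' (x y s s' : ℝ) :
    posPow s y * posPow s' (x - y) * posPow 0 x = posPow s y * posPow s' (x - y) := by
  rcases lt_or_ge 0 y with h | h
  · rcases lt_or_ge 0 (x - y) with h' | h'
    · rw [posPow_zero_of_pos (x := x) (by linarith), mul_one]
    · rw [posPow_of_nonpos h', mul_zero, zero_mul]
  · rw [posPow_of_nonpos h, zero_mul, zero_mul]

/-! ### Pairings of the `[0, ∞]`-valued kernels -/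

section

variable {a : ℝ} (ha : a ∈ Ioo (1 / 2 : ℝ) 1)
include ha

theorem lintegral_productL_mul_productL (t : ℝ) :
    ∫⁻ y₁, ∫⁻ y₂, productL a t y₁ y₂ * productL a t y₁ y₂ =
      (ENNReal.ofReal (1 / (1 - a)) * posPow (1 - a) t) ^ 2 := by
  obtain ⟨ha0, ha1⟩ := ha
  unfold productL
  rw [lintegral_lintegral_sq (by fun_prop) (by fun_prop),
    ← lintegral_posPow_mul_indicator (by linarith)]
  congr 1
  refine lintegral_congr fun y => ?_
  have h1 := posPow_mul_posPow 0 0 (t - y)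
  have h2 := posPow_mul_posPow (-(a / 2)) (-(a / 2)) y
  rw [show (0 : ℝ) + 0 = 0 by ring] at h1
  rw [show -(a / 2) + -(a / 2) = 1 - a - 1 by ring] at h2
  rw [← h2]
  conv_rhs => rw [← h1]
  ring

/-- On `y₂ < y₁` the powers of `y₁` cancel and the inner Beta integral has degree `0`, so a constant
is integrated over `(0, t)`. -/
theorem lintegral_singularL_mul_productL (t : ℝ) :
    ∫⁻ y₁, ∫⁻ y₂, singularL a t y₁ y₂ * productL a t y₁ y₂ =
      2 * (ENNReal.ofReal (beta (1 - a) a) * posPow 1 t) := by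
  have ha0 := ha.1
  have ha1 := ha.2
  unfold singularL
  rw [lintegral_lintegral_symm_add (measurable_halfSingularL a t) (measurable_productL a t)
    (productL_comm a t)]
  congr 1
  have h : ∀ y₁ y₂, halfSingularL a t y₁ y₂ * productL a t y₁ y₂ =
      (posPow 0 (t - y₁) * posPow 0 y₁) *
        (posPow (1 - a - 1) y₂ * posPow (a - 1) (y₁ - y₂)) := fun y₁ y₂ => by
    have h1 := posPow_mul_posPow 0 0 (t - y₁)
    have h2 := posPow_mul_posPow (-(a / 2)) (-(a / 2)) y₂
    have h3 := posPow_mul_posPow (a / 2) (-(a / 2)) y₁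
    have h4 := posPow_mul_posPow_absorb t y₁ y₂ (a - 1)
    rw [show (0 : ℝ) + 0 = 0 by ring] at h1
    rw [show -(a / 2) + -(a / 2) = 1 - a - 1 by ring] at h2
    rw [show a / 2 + -(a / 2) = 0 by ring] at h3
    rw [← h2, ← h3]
    unfold halfSingularL productL
    calc _ = (posPow 0 (t - y₁) * posPow 0 (t - y₁)) * posPow (a - 1) (y₁ - y₂) *
          posPow 0 (t - y₂) * ((posPow (a / 2) y₁ * posPow (-(a / 2)) y₁) *
            (posPow (-(a / 2)) y₂ * posPow (-(a / 2)) y₂)) := by ring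
      _ = _ := by rw [h1, h4]; ring
  simp_rw [h]
  have h2 : ∀ y₁, ∫⁻ y₂, (posPow 0 (t - y₁) * posPow 0 y₁) *
        (posPow (1 - a - 1) y₂ * posPow (a - 1) (y₁ - y₂)) =
      ENNReal.ofReal (beta (1 - a) a) * (posPow (1 - 1) y₁ * posPow 0 (t - y₁)) := fun y₁ => by
    rw [lintegral_const_mul _ (by fun_prop), lintegral_posPow_mul_posPow_sub (by linarith)
      (by linarith)]
    have h1 := posPow_mul_posPow 0 0 y₁
    rw [show (0 : ℝ) + 0 = 0 by ring] at h1
    rw [show 1 - a + a - 1 = 0 by ring, sub_self]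
    calc _ = ENNReal.ofReal (beta (1 - a) a) * ((posPow 0 y₁ * posPow 0 y₁) *
          posPow 0 (t - y₁)) := by ring
      _ = _ := by rw [h1]
  simp_rw [h2]
  rw [lintegral_const_mul _ (by fun_prop), lintegral_posPow_mul_indicator one_pos]
  simp

/-- Here `a > 1/2` enters: the squared singularity `|y₁ - y₂|^{2a-2}` must be integrable. The inner
integral has degree `a - 1` and the factor `y₁^a` raises it to `2a - 1`. -/
theorem lintegral_singularL_mul_singularL (t : ℝ) :
    ∫⁻ y₁, ∫⁻ y₂, singularL a t y₁ y₂ * singularL a t y₁ y₂ =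
      2 * (ENNReal.ofReal (beta (1 - a) (2 * a - 1)) *
        (ENNReal.ofReal (1 / (2 * a)) * posPow (2 * a) t)) := by
  have ha0 := ha.1
  have ha1 := ha.2
  conv_lhs => enter [2, y₁, 2, y₂, 1]; rw [singularL]
  rw [lintegral_lintegral_symm_add (measurable_halfSingularL a t) (measurable_singularL a t)
    (singularL_comm a t)]
  congr 1
  have h : ∀ y₁ y₂, halfSingularL a t y₁ y₂ * singularL a t y₁ y₂ =
      (posPow 0 (t - y₁) * posPow a y₁) *
        (posPow (1 - a - 1) y₂ * posPow (2 * a - 1 - 1) (y₁ - y₂)) := fun y₁ y₂ => by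
    have h1 := posPow_mul_posPow 0 0 (t - y₁)
    have h2 := posPow_mul_posPow (-(a / 2)) (-(a / 2)) y₂
    have h3 := posPow_mul_posPow (a / 2) (a / 2) y₁
    have h4 := posPow_mul_posPow (a - 1) (a - 1) (y₁ - y₂)
    have h5 := posPow_mul_posPow_neg (a - 1) (a - 1) (y₁ - y₂)
    rw [neg_sub] at h5
    rw [show (0 : ℝ) + 0 = 0 by ring] at h1
    rw [show -(a / 2) + -(a / 2) = 1 - a - 1 by ring] at h2
    rw [show a / 2 + a / 2 = a by ring] at h3
    rw [show a - 1 + (a - 1) = 2 * a - 1 - 1 by ring] at h4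
    rw [← h2, ← h3, ← h4]
    conv_rhs => rw [← h1]
    unfold singularL halfSingularL
    calc _ = posPow 0 (t - y₁) * posPow 0 (t - y₁) * (posPow (a / 2) y₁ * posPow (a / 2) y₁) *
          ((posPow (-(a / 2)) y₂ * posPow (-(a / 2)) y₂) *
            (posPow (a - 1) (y₁ - y₂) * posPow (a - 1) (y₁ - y₂))) +
          (posPow (a - 1) (y₁ - y₂) * posPow (a - 1) (y₂ - y₁)) *
          (posPow 0 (t - y₁) * posPow (a / 2) y₁ * posPow (-(a / 2)) y₂ *
            (posPow 0 (t - y₂) * posPow (a / 2) y₂ * posPow (-(a / 2)) y₁)) := by ring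
      _ = _ := by rw [h5, zero_mul, add_zero]
  simp_rw [h]
  have h2 : ∀ y₁, ∫⁻ y₂, (posPow 0 (t - y₁) * posPow a y₁) *
        (posPow (1 - a - 1) y₂ * posPow (2 * a - 1 - 1) (y₁ - y₂)) =
      ENNReal.ofReal (beta (1 - a) (2 * a - 1)) *
        (posPow (2 * a - 1) y₁ * posPow 0 (t - y₁)) := fun y₁ => by
    rw [lintegral_const_mul _ (by fun_prop), lintegral_posPow_mul_posPow_sub (by linarith)
      (by linarith)]
    have h1 := posPow_mul_posPow a (1 - a + (2 * a - 1) - 1) y₁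
    rw [show a + (1 - a + (2 * a - 1) - 1) = 2 * a - 1 by ring] at h1
    rw [← h1]
    ring
  simp_rw [h2]
  rw [lintegral_const_mul _ (by fun_prop), lintegral_posPow_mul_indicator (by linarith)]

theorem lintegral_derivKernel_mul_posPow (x : ℝ) :
    ∫⁻ y, derivKernel a x y * posPow (-(a / 2)) y =
      ENNReal.ofReal (beta (1 - a) (a / 2)) * posPow 0 x := by
  have ha0 := ha.1
  have ha1 := ha.2
  have h : ∀ y, derivKernel a x y * posPow (-(a / 2)) y =
      posPow (a / 2) x * (posPow (1 - a - 1) y * posPow (a / 2 - 1) (x - y)) := fun y => by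
    have h2 := posPow_mul_posPow (-(a / 2)) (-(a / 2)) y
    rw [show -(a / 2) + -(a / 2) = 1 - a - 1 by ring] at h2
    rw [← h2, derivKernel]; ring
  simp_rw [h]
  rw [lintegral_const_mul _ (by fun_prop), lintegral_posPow_mul_posPow_sub (by linarith)
    (by linarith)]
  have h1 := posPow_mul_posPow (a / 2) (1 - a + a / 2 - 1) x
  rw [show a / 2 + (1 - a + a / 2 - 1) = 0 by ring] at h1
  rw [← h1]; ring

/-- The product kernel has rank one, so each `x` in the mixture contributes the square of `∫ ∂ₓK(x,
y) y^{-a/2} dy`, up to constants, and this does not depend on `x > 0`. -/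
theorem lintegral_rosenblattL_mul_productL (t : ℝ) :
    ∫⁻ y₁, ∫⁻ y₂, rosenblattL a t y₁ y₂ * productL a t y₁ y₂ =
      ENNReal.ofReal (beta (1 - a) (a / 2)) ^ 2 * posPow 1 t := by
  have ha0 := ha.1
  have ha1 := ha.2
  unfold rosenblattL productL
  rw [lintegral_lintegral_mixture (by fun_prop) (measurable_derivKernel a)
    (by fun_prop)]
  have h : ∀ x, posPow 0 (t - x) * ∫⁻ y₁, ∫⁻ y₂, (derivKernel a x y₁ * derivKernel a x y₂) *
      ((posPow 0 (t - y₁) * posPow (-(a / 2)) y₁) * (posPow 0 (t - y₂) * posPow (-(a / 2)) y₂)) =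
      ENNReal.ofReal (beta (1 - a) (a / 2)) ^ 2 * (posPow (1 - 1) x * posPow 0 (t - x)) := by
    intro x
    rw [lintegral_lintegral_sq (measurable_derivKernel_right a x) (by fun_prop)]
    rcases lt_or_ge 0 (t - x) with hx | hx
    · have h1 : ∀ y, derivKernel a x y * (posPow 0 (t - y) * posPow (-(a / 2)) y) =
          derivKernel a x y * posPow (-(a / 2)) y := fun y => by
        have h4 := posPow_mul_posPow_absorb t x y (a / 2 - 1)
        rw [posPow_zero_of_pos hx, one_mul] at h4
        rw [derivKernel]
        calc _ = posPow (a / 2) x * posPow (-(a / 2)) y *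
              (posPow (a / 2 - 1) (x - y) * posPow 0 (t - y)) * posPow (-(a / 2)) y := by ring
          _ = _ := by rw [h4]
      simp_rw [h1]
      rw [lintegral_derivKernel_mul_posPow ha, mul_pow, sq (posPow 0 x), posPow_mul_posPow,
        add_zero, sub_self]
      ring
    · rw [posPow_of_nonpos hx]; simp
  simp_rw [h]
  rw [lintegral_const_mul _ (by fun_prop), lintegral_posPow_mul_indicator one_pos]
  simp

theorem lintegral_derivKernel_mul_derivKernel {x x' : ℝ} (hne : x ≠ x') :
    ∫⁻ y, derivKernel a x y * derivKernel a x' y =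
      ENNReal.ofReal (beta (1 - a) (a / 2)) * (posPow 0 x * posPow 0 x' *
        (posPow (a - 1) (x - x') + posPow (a - 1) (x' - x))) := by
  have ha0 := ha.1
  have ha1 := ha.2
  have h : ∀ y, derivKernel a x y * derivKernel a x' y = (posPow (a / 2) x * posPow (a / 2) x') *
      (posPow (-a) y * posPow (a / 2 - 1) (x - y) * posPow (a / 2 - 1) (x' - y)) := fun y => by
    have h2 := posPow_mul_posPow (-(a / 2)) (-(a / 2)) y
    rw [show -(a / 2) + -(a / 2) = -a by ring] at h2
    rw [← h2, derivKernel, derivKernel]; ring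
  simp_rw [h]
  rw [lintegral_const_mul _ (by fun_prop), lintegral_kernel_mul_kernel (by linarith) ha1 hne]
  have h1 := posPow_mul_posPow (a / 2) (-(a / 2)) x
  have h1' := posPow_mul_posPow (a / 2) (-(a / 2)) x'
  rw [add_neg_cancel] at h1 h1'
  rw [← h1, ← h1']; ring

/-- Opening both mixtures leaves the squared Gram kernel of the functions `derivKernel a x`, that
is, a constant times `|x - x'|^{2a-2}` on `(0, t)²`. -/
theorem lintegral_rosenblattL_mul_rosenblattL (t : ℝ) :
    ∫⁻ y₁, ∫⁻ y₂, rosenblattL a t y₁ y₂ * rosenblattL a t y₁ y₂ =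
      ENNReal.ofReal (beta (1 - a) (a / 2)) ^ 2 * (2 * (ENNReal.ofReal (1 / (2 * a - 1)) *
        (ENNReal.ofReal (1 / (2 * a)) * posPow (2 * a) t))) := by
  have ha0 := ha.1
  have ha1 := ha.2
  set b := ENNReal.ofReal (beta (1 - a) (a / 2)) with hb
  set R : ℝ → ℝ → ℝ≥0∞ := fun x x' => posPow (a - 1) (x - x') with hR
  set G : ℝ → ℝ → ℝ≥0∞ := fun x x' => (posPow 0 (t - x) * posPow 0 x) *
    (posPow 0 (t - x') * posPow 0 x') * (R x x' + R x' x) with hG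
  have hRm : Measurable fun p : ℝ × ℝ => R p.1 p.2 := by simp only [hR]; fun_prop
  have hGm : Measurable fun p : ℝ × ℝ => G p.1 p.2 := by simp only [hG, hR]; fun_prop
  conv_lhs => enter [2, y₁, 2, y₂, 1]; rw [rosenblattL]
  rw [lintegral_lintegral_mixture (by fun_prop) (measurable_derivKernel a)
    (measurable_rosenblattL a t)]
  have hin : ∀ x, ∫⁻ y₁, ∫⁻ y₂, (derivKernel a x y₁ * derivKernel a x y₂) *
      rosenblattL a t y₁ y₂ = ∫⁻ x', posPow 0 (t - x') * (b * (posPow 0 x * posPow 0 x' *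
        (R x x' + R x' x))) ^ 2 := fun x => by
    simp_rw [mul_comm (derivKernel a x _ * derivKernel a x _) (rosenblattL a t _ _)]
    unfold rosenblattL
    have hk := measurable_derivKernel_right a x
    rw [lintegral_lintegral_mixture (by fun_prop) (measurable_derivKernel a)
      ((hk.comp measurable_fst).mul (hk.comp measurable_snd))]
    -- The Gram formula is available only for `x' ≠ x`, which excludes a null set.
    refine lintegral_congr_ae ?_
    filter_upwards [Measure.ae_ne volume x] with x' hx'
    rw [lintegral_lintegral_sq (measurable_derivKernel_right a x') hk]
    simp_rw [mul_comm (derivKernel a x' _)]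
    rw [lintegral_derivKernel_mul_derivKernel ha hx'.symm]
  simp_rw [hin]
  have h2 : ∀ x, posPow 0 (t - x) * ∫⁻ x', posPow 0 (t - x') * (b * (posPow 0 x * posPow 0 x' *
      (R x x' + R x' x))) ^ 2 = b ^ 2 * ∫⁻ x', (R x x' + R x' x) * G x x' := fun x => by
    rw [← lintegral_const_mul _ (by simp only [hR]; fun_prop),
      ← lintegral_const_mul _ (by simp only [hR, hG]; fun_prop)]
    refine lintegral_congr fun x' => ?_
    have e : ∀ z, posPow 0 z * posPow 0 z = posPow 0 z := fun z => by
      rw [posPow_mul_posPow, add_zero]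
    simp only [hG]
    calc _ = b ^ 2 * ((R x x' + R x' x) * (posPow 0 (t - x) * (posPow 0 x * posPow 0 x) *
          (posPow 0 (t - x') * (posPow 0 x' * posPow 0 x')) * (R x x' + R x' x))) := by ring
      _ = _ := by rw [e, e]
  simp_rw [h2]
  have hGs : ∀ x y, G x y = G y x := fun x y => by simp only [hG]; ring
  rw [lintegral_const_mul _ (by
      have : Measurable fun p : ℝ × ℝ => (R p.1 p.2 + R p.2 p.1) * G p.1 p.2 :=
        (hRm.add (hRm.comp measurable_swap)).mul hGm
      exact this.lintegral_prod_right'),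
    lintegral_lintegral_symm_add hRm hGm hGs]
  congr 2
  have h3 : ∀ x x', R x x' * G x x' = posPow 0 (t - x) *
      (posPow (1 - 1) x' * posPow (2 * a - 1 - 1) (x - x')) := fun x x' => by
    have h4 := posPow_mul_posPow (a - 1) (a - 1) (x - x')
    have h5 := posPow_mul_posPow_neg (a - 1) (a - 1) (x - x')
    rw [neg_sub] at h5
    rw [show a - 1 + (a - 1) = 2 * a - 1 - 1 by ring] at h4
    have h6 := posPow_mul_posPow_absorb t x x' (2 * a - 1 - 1)
    have h7 := posPow_mul_posPow_absorb' x x' 0 (2 * a - 1 - 1)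
    simp only [hG, hR]
    rw [sub_self]
    calc _ = posPow 0 (t - x) * (posPow (a - 1) (x - x') * posPow (a - 1) (x - x')) *
          posPow 0 (t - x') * (posPow 0 x * posPow 0 x') +
          (posPow (a - 1) (x - x') * posPow (a - 1) (x' - x)) * (posPow 0 (t - x) *
            posPow 0 x * (posPow 0 (t - x') * posPow 0 x')) := by ring
      _ = posPow 0 (t - x) * (posPow 0 x' * posPow (2 * a - 1 - 1) (x - x') * posPow 0 x) := by
        rw [h5, zero_mul, add_zero, h4, h6]; ring
      _ = _ := by rw [h7]
  simp_rw [h3]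
  have h4 : ∀ x, ∫⁻ x', posPow 0 (t - x) *
      (posPow (1 - 1) x' * posPow (2 * a - 1 - 1) (x - x')) =
      ENNReal.ofReal (1 / (2 * a - 1)) * (posPow (2 * a - 1) x * posPow 0 (t - x)) := fun x => by
    rw [lintegral_const_mul _ (by fun_prop), lintegral_posPow_mul_posPow_sub one_pos
      (by linarith), beta_comm, beta_one_right (by linarith), add_sub_cancel_left]
    ring
  simp_rw [h4]
  rw [lintegral_const_mul _ (by fun_prop), lintegral_posPow_mul_indicator (by linarith)]

omit ha in
theorem measurable_triangleIntegrand (a x : ℝ) : Measurable fun p : ℝ × ℝ =>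
    posPow 0 p.1 * (posPow (-a) p.2 * posPow (a / 2 - 1) (x - p.1) *
      posPow (a / 2 - 1) (x - p.2) * posPow (a - 1) (p.1 - p.2)) := by
  fun_prop

omit ha in
-- Homogeneity: the exponents `-a`, `a/2 - 1` twice and `a - 1`, together with `2` from the two
-- integration variables, add up to `a - 1`.
theorem triangleL_eq (a x : ℝ) : triangleL a x = posPow (a - 1) x * triangleL a 1 := by
  rcases lt_or_ge 0 x with hx | hx
  · have hm := measurable_triangleIntegrand a x
    unfold triangleL
    rw [lintegral_eq_mul_lintegral_comp_mul hm.lintegral_prod_right' hx]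
    have hin : ∀ s, ∫⁻ r, posPow 0 (x * s) * (posPow (-a) r * posPow (a / 2 - 1) (x - x * s) *
        posPow (a / 2 - 1) (x - r) * posPow (a - 1) (x * s - r)) =
        (posPow 1 x * (posPow 0 x * posPow (-a) x * posPow (a / 2 - 1) x * posPow (a / 2 - 1) x *
          posPow (a - 1) x)) * ∫⁻ r, posPow 0 s * (posPow (-a) r * posPow (a / 2 - 1) (1 - s) *
        posPow (a / 2 - 1) (1 - r) * posPow (a - 1) (s - r)) := fun s => by
      rw [lintegral_eq_mul_lintegral_comp_mul (by fun_prop) hx,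
        ← lintegral_const_mul _ (by fun_prop), ← lintegral_const_mul _ (by fun_prop)]
      refine lintegral_congr fun r => ?_
      rw [show x - x * s = x * (1 - s) by ring, show x - x * r = x * (1 - r) by ring,
        show x * s - x * r = x * (s - r) by ring, posPow_mul_left hx, posPow_mul_left hx,
        posPow_mul_left hx, posPow_mul_left hx, posPow_mul_left hx,
        show ENNReal.ofReal x = posPow 1 x by simp [posPow_of_pos hx]]
      ring
    simp_rw [hin]
    rw [lintegral_const_mul _ (measurable_triangleIntegrand a 1).lintegral_prod_right', ← mul_assoc,
      show ENNReal.ofReal x = posPow 1 x by simp [posPow_of_pos hx]]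
    congr 1
    simp only [posPow_mul_posPow]
    congr 1; ring
  · rw [posPow_of_nonpos hx, zero_mul, triangleL]
    refine (lintegral_congr fun s => (lintegral_congr fun r => ?_).trans lintegral_zero).trans
      lintegral_zero
    rcases lt_or_ge 0 s with hs | hs
    · rw [posPow_of_nonpos (x := x - s) (by linarith)]; simp
    · rw [posPow_of_nonpos hs, zero_mul]

/-- For fixed `x` each half of the singular kernel contributes `x^a` times the integral over the
triangle of side `x`, of degree `2a - 1` in all by `triangleL_eq`. -/
theorem lintegral_rosenblattL_mul_singularL (t : ℝ) :
    ∫⁻ y₁, ∫⁻ y₂, rosenblattL a t y₁ y₂ * singularL a t y₁ y₂ =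
      2 * (triangleL a 1 * (ENNReal.ofReal (1 / (2 * a)) * posPow (2 * a) t)) := by
  have ha0 := ha.1
  have ha1 := ha.2
  unfold rosenblattL
  rw [lintegral_lintegral_mixture (by fun_prop) (measurable_derivKernel a)
    (measurable_singularL a t)]
  have h : ∀ x, posPow 0 (t - x) * ∫⁻ y₁, ∫⁻ y₂, (derivKernel a x y₁ * derivKernel a x y₂) *
      singularL a t y₁ y₂ =
      2 * (triangleL a 1 * (posPow (2 * a - 1) x * posPow 0 (t - x))) := fun x => by
    rcases lt_or_ge 0 (t - x) with hx | hx
    swap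
    · rw [posPow_of_nonpos hx]; simp
    have hk := measurable_derivKernel_right a x
    simp_rw [mul_comm (derivKernel a x _ * derivKernel a x _)]
    unfold singularL
    rw [lintegral_lintegral_symm_add (measurable_halfSingularL a t)
      ((hk.comp measurable_fst).mul (hk.comp measurable_snd)) fun y z => mul_comm _ _]
    have h1 : ∀ y₁ y₂, halfSingularL a t y₁ y₂ * (derivKernel a x y₁ * derivKernel a x y₂) =
        posPow a x * (posPow 0 y₁ * (posPow (-a) y₂ * posPow (a / 2 - 1) (x - y₁) *
          posPow (a / 2 - 1) (x - y₂) * posPow (a - 1) (y₁ - y₂))) := fun y₁ y₂ => by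
      have h4 := posPow_mul_posPow_absorb t x y₁ (a / 2 - 1)
      rw [posPow_zero_of_pos hx, one_mul] at h4
      have h2 := posPow_mul_posPow (-(a / 2)) (-(a / 2)) y₂
      have h3 := posPow_mul_posPow (a / 2) (-(a / 2)) y₁
      have h5 := posPow_mul_posPow (a / 2) (a / 2) x
      rw [show -(a / 2) + -(a / 2) = -a by ring] at h2
      rw [add_neg_cancel] at h3
      rw [add_halves] at h5
      rw [← h2, ← h3, ← h5]
      unfold halfSingularL derivKernel
      calc _ = (posPow (a / 2 - 1) (x - y₁) * posPow 0 (t - y₁)) * (posPow (a / 2) x *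
            posPow (a / 2) x * (posPow (a / 2) y₁ * posPow (-(a / 2)) y₁ * (posPow (-(a / 2)) y₂ *
              posPow (-(a / 2)) y₂ * posPow (a / 2 - 1) (x - y₂) *
                posPow (a - 1) (y₁ - y₂)))) := by ring
        _ = _ := by rw [h4]; ring
    have hm := measurable_triangleIntegrand a x
    have h2 : ∫⁻ y₁, ∫⁻ y₂, halfSingularL a t y₁ y₂ * (derivKernel a x y₁ * derivKernel a x y₂) =
        posPow a x * triangleL a x := by
      simp_rw [h1]
      rw [triangleL, ← lintegral_const_mul _ hm.lintegral_prod_right']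
      exact lintegral_congr fun y₁ => lintegral_const_mul _ (by fun_prop)
    rw [h2, triangleL_eq, ← mul_assoc (posPow a x), posPow_mul_posPow,
      show a + (a - 1) = 2 * a - 1 by ring]
    ring
  simp_rw [h]
  rw [lintegral_const_mul _ (by fun_prop), lintegral_const_mul _ (by fun_prop),
    lintegral_posPow_mul_indicator (by linarith)]

end

/-! ### Real kernels -/

/-- The real function `F` is represented by the `[0, ∞]`-valued square integrable function `F'`. -/
structure IsRepresentedBy (F : ℝ × ℝ → ℝ) (F' : ℝ → ℝ → ℝ≥0∞) : Prop where
  measurable : Measurable fun p : ℝ × ℝ => F' p.1 p.2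
  ae_eq : ∀ᵐ p : ℝ × ℝ, F p = (F' p.1 p.2).toReal
  lintegral_ne_top : ∫⁻ x, ∫⁻ y, F' x y * F' x y ≠ ∞

namespace IsRepresentedBy

variable {F G : ℝ × ℝ → ℝ} {F' G' : ℝ → ℝ → ℝ≥0∞}

theorem ae_lt_top (hF : IsRepresentedBy F F') : ∀ᵐ p : ℝ × ℝ, F' p.1 p.2 < ∞ := by
  have h := hF.lintegral_ne_top
  have hm : Measurable fun p : ℝ × ℝ => F' p.1 p.2 * F' p.1 p.2 :=
    hF.measurable.mul hF.measurable
  have e := lintegral_prod (μ := volume) (ν := volume) _ hm.aemeasurable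
  rw [← Measure.volume_eq_prod] at e
  rw [← e] at h
  filter_upwards [MeasureTheory.ae_lt_top hm h] with p hp
  by_contra hc
  simp [not_lt_top_iff.1 hc] at hp

theorem integral_mul (hF : IsRepresentedBy F F') (hG : IsRepresentedBy G G') :
    ∫ p, F p * G p = (∫⁻ x, ∫⁻ y, F' x y * G' x y).toReal := by
  have hm : Measurable fun p : ℝ × ℝ => F' p.1 p.2 * G' p.1 p.2 :=
    hF.measurable.mul hG.measurable
  have e := lintegral_prod (μ := volume) (ν := volume) _ hm.aemeasurable
  rw [← Measure.volume_eq_prod] at e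
  rw [← e, ← integral_toReal hm.aemeasurable]
  · refine integral_congr_ae ?_
    filter_upwards [hF.ae_eq, hG.ae_eq] with p h1 h2
    rw [h1, h2, ENNReal.toReal_mul]
  · filter_upwards [hF.ae_lt_top, hG.ae_lt_top] with p h1 h2
    exact ENNReal.mul_lt_top h1 h2

theorem memLp (hF : IsRepresentedBy F F') : MemLp F 2 volume := by
  have hmeas : AEStronglyMeasurable F volume :=
    hF.measurable.ennreal_toReal.aestronglyMeasurable.congr
      (hF.ae_eq.mono fun p hp => hp.symm)
  rw [memLp_two_iff_integrable_sq hmeas]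
  have hm : Measurable fun p : ℝ × ℝ => F' p.1 p.2 * F' p.1 p.2 :=
    hF.measurable.mul hF.measurable
  have e := lintegral_prod (μ := volume) (ν := volume) _ hm.aemeasurable
  rw [← Measure.volume_eq_prod] at e
  have h := hF.lintegral_ne_top
  rw [← e] at h
  refine (integrable_toReal_of_lintegral_ne_top hm.aemeasurable h).congr ?_
  filter_upwards [hF.ae_eq] with p hp
  rw [hp, ENNReal.toReal_mul, sq]

end IsRepresentedBy

theorem ae_pair_ne {c : ℝ} : ∀ᵐ p : ℝ × ℝ, p.1 ≠ c ∧ p.2 ≠ c := by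
  have h := Measure.ae_ne (volume : Measure ℝ) c
  rw [Measure.volume_eq_prod]
  filter_upwards [Measure.quasiMeasurePreserving_fst.ae h,
    Measure.quasiMeasurePreserving_snd.ae h] with p h1 h2 using ⟨h1, h2⟩

theorem ae_fst_ne_snd : ∀ᵐ p : ℝ × ℝ, p.1 ≠ p.2 := by
  rw [Measure.volume_eq_prod]
  have hm : MeasurableSet {p : ℝ × ℝ | p.1 ≠ p.2} :=
    (measurableSet_eq_fun measurable_fst measurable_snd).compl
  rw [Measure.ae_prod_iff_ae_ae hm]
  filter_upwards with x
  filter_upwards [Measure.ae_ne volume x] with y hy using hy.symm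

/-- `(y₁ y₂)^{-a/2}` cut off to `[0, t]²`. -/
noncomputable def productCut (a t : ℝ) (p : ℝ × ℝ) : ℝ :=
  (Icc 0 t ×ˢ Icc 0 t).indicator (fun p => (p.1 * p.2) ^ (-(a / 2))) p

/-- The singular kernel cut off to `[0, t]²`. -/
noncomputable def singularCut (a t : ℝ) (p : ℝ × ℝ) : ℝ :=
  (Icc 0 t ×ˢ Icc 0 t).indicator (fun p => singularKernel a p.1 p.2) p

/-- The closed cut-off of the real kernels and the open one hidden in `posPow` can differ only at
the endpoints, which form a null set. -/
theorem mem_or_of_ne {t x : ℝ} (h0 : x ≠ 0) (ht : x ≠ t) :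
    (0 < x ∧ x < t) ∨ (x ∉ Icc 0 t ∧ (x ≤ 0 ∨ t - x ≤ 0)) := by
  rcases lt_or_gt_of_ne h0 with h | h
  · exact Or.inr ⟨fun h' => absurd h'.1 (not_le.2 h), Or.inl h.le⟩
  · rcases lt_or_gt_of_ne ht with h' | h'
    · exact Or.inl ⟨h, h'⟩
    · exact Or.inr ⟨fun h'' => absurd h''.2 (not_le.2 h'), Or.inr (by linarith)⟩

section

variable {a : ℝ} (ha : a ∈ Ioo (1 / 2 : ℝ) 1)
include ha

theorem isRepresentedBy_productCut (t : ℝ) :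
    IsRepresentedBy (productCut a t) (productL a t) where
  measurable := measurable_productL a t
  lintegral_ne_top := by
    rw [lintegral_productL_mul_productL ha]
    exact ENNReal.pow_ne_top (ENNReal.mul_ne_top ENNReal.ofReal_ne_top (posPow_ne_top _ _))
  ae_eq := by
    filter_upwards [ae_pair_ne (c := 0), ae_pair_ne (c := t)] with ⟨x, y⟩ h0 ht
    have out : ∀ z : ℝ, z ≤ 0 ∨ t - z ≤ 0 → posPow 0 (t - z) * posPow (-(a / 2)) z = 0 := by
      rintro z (h | h)
      · rw [posPow_of_nonpos h, mul_zero]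
      · rw [posPow_of_nonpos h, zero_mul]
    simp only [productL, productCut]
    rcases mem_or_of_ne h0.1 ht.1 with hx | hx
    · rcases mem_or_of_ne h0.2 ht.2 with hy | hy
      · rw [indicator_of_mem (show (x, y) ∈ Icc 0 t ×ˢ Icc 0 t from
          ⟨⟨hx.1.le, hx.2.le⟩, ⟨hy.1.le, hy.2.le⟩⟩), posPow_zero_of_pos (sub_pos.2 hx.2),
          posPow_zero_of_pos (sub_pos.2 hy.2), one_mul, one_mul, ENNReal.toReal_mul,
          toReal_posPow hx.1, toReal_posPow hy.1, Real.mul_rpow hx.1.le hy.1.le]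
      · rw [indicator_of_notMem (fun h => hy.1 h.2), out y hy.2, mul_zero, ENNReal.toReal_zero]
    · rw [indicator_of_notMem (fun h => hx.1 h.1), out x hx.2, zero_mul, ENNReal.toReal_zero]

theorem isRepresentedBy_singularCut (t : ℝ) :
    IsRepresentedBy (singularCut a t) (singularL a t) where
  measurable := measurable_singularL a t
  lintegral_ne_top := by
    rw [lintegral_singularL_mul_singularL ha]
    exact ENNReal.mul_ne_top (by simp) (ENNReal.mul_ne_top ENNReal.ofReal_ne_top
      (ENNReal.mul_ne_top ENNReal.ofReal_ne_top (posPow_ne_top _ _)))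
  ae_eq := by
    have half : ∀ {x y : ℝ}, x ≠ 0 → x ≠ t → y ≠ 0 → y ≠ t → y < x →
        singularCut a t (x, y) = (singularL a t x y).toReal := by
      intro x y hx0 hxt hy0 hyt hyx
      have h2 : halfSingularL a t y x = 0 := by
        rw [halfSingularL, posPow_of_nonpos (x := y - x) (by linarith), mul_zero]
      rw [singularL, h2, add_zero]
      simp only [singularCut, halfSingularL]
      rcases mem_or_of_ne hx0 hxt with hx | hx
      · rcases mem_or_of_ne hy0 hyt with hy | hy
        · rw [indicator_of_mem (show (x, y) ∈ Icc 0 t ×ˢ Icc 0 t from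
            ⟨⟨hx.1.le, hx.2.le⟩, ⟨hy.1.le, hy.2.le⟩⟩), posPow_zero_of_pos (sub_pos.2 hx.2),
            one_mul, ENNReal.toReal_mul, ENNReal.toReal_mul, toReal_posPow hx.1,
            toReal_posPow hy.1, toReal_posPow (sub_pos.2 hyx), singularKernel, max_eq_left hyx.le,
            min_eq_right hyx.le, abs_of_pos (sub_pos.2 hyx)]
        · rw [indicator_of_notMem (fun h => hy.1 h.2)]
          rcases hy.right with h | h
          · rw [posPow_of_nonpos h]; simp
          · linarith [hx.2]
      · rw [indicator_of_notMem (fun h => hx.1 h.1)]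
        rcases hx.2 with h | h
        · rw [posPow_of_nonpos h]; simp
        · rw [posPow_of_nonpos h]; simp
    filter_upwards [ae_pair_ne (c := 0), ae_pair_ne (c := t), ae_fst_ne_snd] with ⟨x, y⟩ h0 ht hne
    rcases lt_or_gt_of_ne hne with h | h
    · rw [singularL_comm, ← half h0.2 ht.2 h0.1 ht.1 h]
      simp only [singularCut, Set.indicator, Set.mem_prod, and_comm, singularKernel, max_comm x y,
        min_comm x y, abs_sub_comm x y]
    · exact half h0.1 ht.1 h0.2 ht.2 h

/-- Fundamental theorem of calculus in the upper limit: the integrand is continuous at `x > y`, and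
its singularity at `y` is integrable because `a/2 - 1 > -1`. -/
theorem deriv_K {x y : ℝ} (hyx : y < x) :
    deriv (fun x' => K ((a + 1) / 2) x' y) x = cConst ((a + 1) / 2) *
      (x ^ (a / 2) * y ^ (-(a / 2)) * (x - y) ^ (a / 2 - 1)) := by
  have ha0 := ha.1
  have ha1 := ha.2
  have e1 : (a + 1) / 2 - 3 / 2 = a / 2 - 1 := by ring
  have e2 : (a + 1) / 2 - 1 / 2 = a / 2 := by ring
  have e3 : 1 / 2 - (a + 1) / 2 = -(a / 2) := by ring
  simp only [K, e1, e2, e3]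
  have hint : IntervalIntegrable (fun u => (u - y) ^ (a / 2 - 1) * u ^ (a / 2)) volume y x := by
    have h := (intervalIntegral.intervalIntegrable_rpow' (a := 0) (b := x - y)
      (r := a / 2 - 1) (by linarith)).comp_sub_right y
    rw [zero_add, sub_add_cancel] at h
    refine h.mul_continuousOn ?_
    exact (Real.continuous_rpow_const (by linarith)).continuousOn
  have hm : StronglyMeasurable fun u : ℝ => (u - y) ^ (a / 2 - 1) * u ^ (a / 2) :=
    Measurable.stronglyMeasurable (by fun_prop)
  have hc : ContinuousAt (fun u : ℝ => (u - y) ^ (a / 2 - 1) * u ^ (a / 2)) x := by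
    refine ContinuousAt.mul ?_ (Real.continuousAt_rpow_const _ _ (Or.inr (by linarith)))
    exact (continuousAt_id.sub continuousAt_const).rpow_const (Or.inl (sub_pos.2 hyx).ne')
  have hd := intervalIntegral.integral_hasDerivAt_right hint
    hm.stronglyMeasurableAtFilter hc
  rw [(hd.const_mul _).deriv]
  ring

/-- The constant in front of the kernel of the Rosenblatt process. -/
noncomputable def kernelConst (a : ℝ) : ℝ := dConst a * cConst ((a + 1) / 2) ^ 2

omit ha in
theorem Q_eq_zero_of_notMem_left {t x y : ℝ} (hx : x ∉ Icc 0 t) : Q a t x y = 0 := by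
  simp [Q, indicator_of_notMem hx]

omit ha in
theorem Q_eq_zero_of_notMem_right {t x y : ℝ} (hy : y ∉ Icc 0 t) : Q a t x y = 0 := by
  simp [Q, indicator_of_notMem hy]

omit ha in
theorem Q_comm (t x y : ℝ) : Q a t x y = Q a t y x := by
  simp only [Q, max_comm x y]
  rw [mul_assoc (dConst a), mul_comm ((Icc 0 t).indicator 1 x), ← mul_assoc]
  congr 1
  refine intervalIntegral.integral_congr fun x _ => mul_comm _ _

omit ha in
theorem derivKernel_eq_zero {x y : ℝ} (h : y ≤ 0 ∨ x ≤ y) : derivKernel a x y = 0 := by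
  rcases h with h | h
  · simp [derivKernel, posPow_of_nonpos h]
  · simp [derivKernel, posPow_of_nonpos (sub_nonpos.2 h)]

omit ha in
theorem rosenblattL_comm (t x y : ℝ) : rosenblattL a t x y = rosenblattL a t y x := by
  unfold rosenblattL
  exact lintegral_congr fun z => by ring

omit ha in
theorem rosenblattL_eq_zero {t x y : ℝ} (hx : x ≤ 0 ∨ t - x ≤ 0) : rosenblattL a t x y = 0 := by
  unfold rosenblattL
  refine (lintegral_congr fun z => ?_).trans lintegral_zero
  rcases hx with h | h
  · rw [derivKernel_eq_zero (Or.inl h), zero_mul, mul_zero]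
  · rcases lt_or_ge z t with h' | h'
    · rw [derivKernel_eq_zero (Or.inr (by linarith)), zero_mul, mul_zero]
    · rw [posPow_of_nonpos (by linarith), zero_mul]

theorem Q_eq_toReal {t x y : ℝ} (hx0 : 0 < x) (hxt : x < t) (hy0 : 0 < y) (hyt : y < t) :
    Q a t x y = kernelConst a * (rosenblattL a t x y).toReal := by
  have hmt : max x y < t := max_lt hxt hyt
  rw [Q, indicator_of_mem (show x ∈ Icc 0 t from ⟨hx0.le, hxt.le⟩),
    indicator_of_mem (show y ∈ Icc 0 t from ⟨hy0.le, hyt.le⟩),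
    intervalIntegral.integral_of_le hmt.le, integral_Ioc_eq_integral_Ioo]
  have hcong : ∀ z ∈ Ioo (max x y) t, deriv (fun x' => K ((a + 1) / 2) x' x) z *
      deriv (fun x' => K ((a + 1) / 2) x' y) z = cConst ((a + 1) / 2) ^ 2 *
        ((z ^ (a / 2) * x ^ (-(a / 2)) * (z - x) ^ (a / 2 - 1)) *
          (z ^ (a / 2) * y ^ (-(a / 2)) * (z - y) ^ (a / 2 - 1))) := fun z hz => by
    rw [deriv_K ha ((le_max_left _ _).trans_lt hz.1),
      deriv_K ha ((le_max_right _ _).trans_lt hz.1)]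
    ring
  rw [setIntegral_congr_fun measurableSet_Ioo hcong, integral_const_mul,
    integral_eq_lintegral_of_nonneg_ae]
  · have hl : ∀ z ∈ Ioo (max x y) t, ENNReal.ofReal
        ((z ^ (a / 2) * x ^ (-(a / 2)) * (z - x) ^ (a / 2 - 1)) *
          (z ^ (a / 2) * y ^ (-(a / 2)) * (z - y) ^ (a / 2 - 1))) =
        posPow 0 (t - z) * (derivKernel a z x * derivKernel a z y) := fun z hz => by
      have h1 : 0 < z - x := sub_pos.2 ((le_max_left _ _).trans_lt hz.1)
      have h2 : 0 < z - y := sub_pos.2 ((le_max_right _ _).trans_lt hz.1)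
      have h3 : 0 < z := by linarith
      rw [posPow_zero_of_pos (sub_pos.2 hz.2), one_mul, derivKernel, derivKernel, posPow_of_pos h1,
        posPow_of_pos h2, posPow_of_pos h3, posPow_of_pos hx0, posPow_of_pos hy0,
        ENNReal.ofReal_mul (by positivity), ENNReal.ofReal_mul (by positivity),
        ENNReal.ofReal_mul (by positivity), ENNReal.ofReal_mul (by positivity),
        ENNReal.ofReal_mul (by positivity)]
    rw [setLIntegral_congr_fun measurableSet_Ioo hl, setLIntegral_eq_of_support_subset]
    · simp only [rosenblattL, kernelConst, Pi.one_apply]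
      ring
    · refine Function.support_subset_iff'.2 fun z hz => ?_
      rcases lt_or_ge z t with h | h
      · rcases le_max_iff.1 (not_lt.1 fun h' => hz ⟨h', h⟩) with h' | h'
        · rw [derivKernel_eq_zero (Or.inr h'), zero_mul, mul_zero]
        · rw [derivKernel_eq_zero (Or.inr h'), mul_zero, mul_zero]
      · rw [posPow_of_nonpos (by linarith), zero_mul]
  · refine (ae_restrict_iff' measurableSet_Ioo).2 (Eventually.of_forall fun z hz => ?_)
    have h1 : 0 < z - x := sub_pos.2 ((le_max_left _ _).trans_lt hz.1)
    have h2 : 0 < z - y := sub_pos.2 ((le_max_right _ _).trans_lt hz.1)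
    have h3 : 0 < z := by linarith
    simp only [Pi.zero_apply]
    positivity
  · exact Measurable.aestronglyMeasurable (by fun_prop)

theorem kernelConst_nonneg : 0 ≤ kernelConst a := by
  have := ha.1
  unfold kernelConst dConst
  positivity

omit ha in
theorem lintegral_const_mul_rosenblattL_sq (t : ℝ) :
    ∫⁻ x, ∫⁻ y, (ENNReal.ofReal (kernelConst a) * rosenblattL a t x y) *
      (ENNReal.ofReal (kernelConst a) * rosenblattL a t x y) =
      ENNReal.ofReal (kernelConst a) ^ 2 *
        ∫⁻ x, ∫⁻ y, rosenblattL a t x y * rosenblattL a t x y := by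
  rw [← lintegral_const_mul' _ _ (ENNReal.pow_ne_top ENNReal.ofReal_ne_top)]
  refine lintegral_congr fun x => ?_
  rw [← lintegral_const_mul' _ _ (ENNReal.pow_ne_top ENNReal.ofReal_ne_top)]
  exact lintegral_congr fun y => by ring

theorem isRepresentedBy_Q (t : ℝ) : IsRepresentedBy (fun p => Q a t p.1 p.2)
    (fun x y => ENNReal.ofReal (kernelConst a) * rosenblattL a t x y) where
  measurable := (measurable_rosenblattL a t).const_mul _
  lintegral_ne_top := by
    rw [lintegral_const_mul_rosenblattL_sq, lintegral_rosenblattL_mul_rosenblattL ha]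
    have h1 := posPow_ne_top (2 * a) t
    finiteness
  ae_eq := by
    filter_upwards [ae_pair_ne (c := 0), ae_pair_ne (c := t)] with ⟨x, y⟩ h0 ht
    simp only
    rcases mem_or_of_ne h0.1 ht.1 with hx | hx
    · rcases mem_or_of_ne h0.2 ht.2 with hy | hy
      · rw [Q_eq_toReal ha hx.1 hx.2 hy.1 hy.2, ENNReal.toReal_mul,
          ENNReal.toReal_ofReal (kernelConst_nonneg ha)]
      · rw [Q_eq_zero_of_notMem_right hy.1, rosenblattL_comm, rosenblattL_eq_zero hy.2]
        simp
    · rw [Q_eq_zero_of_notMem_left hx.1, rosenblattL_eq_zero hx.2]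
      simp

end

/-! ### The Gram matrix of the kernels -/

/-- This covers `t = 0`; exponent `0` is excluded since `posPow 0 0 = 0` whereas the real power is
`1`. -/
theorem toReal_posPow_of_nonneg {t s : ℝ} (ht : 0 ≤ t) (hs : s ≠ 0) :
    (posPow s t).toReal = t ^ s := by
  rcases ht.eq_or_lt with rfl | h
  · rw [posPow_of_nonpos le_rfl, ENNReal.toReal_zero, Real.zero_rpow hs]
  · exact toReal_posPow h s

theorem lintegral_lintegral_mul_le {F : ℝ → ℝ → ℝ≥0∞}
    (hF : Measurable fun p : ℝ × ℝ => F p.1 p.2) (G : ℝ → ℝ → ℝ≥0∞) :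
    ∫⁻ x, ∫⁻ y, F x y * G x y ≤
      (∫⁻ x, ∫⁻ y, F x y * F x y) + ∫⁻ x, ∫⁻ y, G x y * G x y := by
  have hm : Measurable fun p : ℝ × ℝ => F p.1 p.2 * F p.1 p.2 := hF.mul hF
  have hmx : ∀ x, Measurable fun y => F x y * F x y := fun x =>
    hm.comp (measurable_const.prodMk measurable_id)
  rw [← lintegral_add_left hm.lintegral_prod_right']
  refine lintegral_mono fun x => ?_
  dsimp only
  rw [← lintegral_add_left (hmx x)]
  refine lintegral_mono fun y => ?_
  dsimp only
  rcases le_total (F x y) (G x y) with h | h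
  · exact (mul_le_mul_left h _).trans le_add_self
  · exact (mul_le_mul_right h _).trans le_self_add

section

variable {a : ℝ} (ha : a ∈ Ioo (1 / 2 : ℝ) 1) {t : ℝ} (ht : 0 ≤ t)
include ha

/-- The pairing of `rosenblattL` with `singularL` at `t = 1` is a positive multiple of this
integral, and `F G ≤ F² + G²` bounds it by two norms already known to be finite. -/
theorem triangleL_ne_top : triangleL a 1 ≠ ∞ := by
  have ha0 := ha.1
  have hq := lintegral_rosenblattL_mul_rosenblattL ha 1
  have hs := lintegral_singularL_mul_singularL ha 1
  have hqs := lintegral_rosenblattL_mul_singularL ha 1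
  have hle := lintegral_lintegral_mul_le (measurable_rosenblattL a 1) (singularL a 1)
  rw [hq, hs, hqs, posPow_of_pos one_pos] at hle
  intro hJ
  rw [hJ, ENNReal.top_mul, ENNReal.mul_top (by norm_num), top_le_iff] at hle
  · refine absurd hle ?_
    finiteness
  · simp
    linarith

theorem integral_eq_toReal_triangleL :
    ∫ s in (0 : ℝ)..1, ∫ r in (0 : ℝ)..s,
      r ^ (-a) * (1 - s) ^ (a / 2 - 1) * (1 - r) ^ (a / 2 - 1) * (s - r) ^ (a - 1) =
      (triangleL a 1).toReal := by
  have hm := measurable_triangleIntegrand a 1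
  have hin : ∀ s ∈ Ioo (0 : ℝ) 1, ∫ r in (0 : ℝ)..s,
      r ^ (-a) * (1 - s) ^ (a / 2 - 1) * (1 - r) ^ (a / 2 - 1) * (s - r) ^ (a - 1) =
      (∫⁻ r, posPow 0 s * (posPow (-a) r * posPow (a / 2 - 1) (1 - s) *
        posPow (a / 2 - 1) (1 - r) * posPow (a - 1) (s - r))).toReal := fun s hs => by
    have h1s : 0 < 1 - s := sub_pos.2 hs.2
    rw [intervalIntegral.integral_of_le hs.1.le, integral_Ioc_eq_integral_Ioo,
      integral_eq_lintegral_of_nonneg_ae]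
    · have hl : ∀ r ∈ Ioo 0 s, ENNReal.ofReal (r ^ (-a) * (1 - s) ^ (a / 2 - 1) *
          (1 - r) ^ (a / 2 - 1) * (s - r) ^ (a - 1)) = posPow 0 s * (posPow (-a) r *
            posPow (a / 2 - 1) (1 - s) * posPow (a / 2 - 1) (1 - r) * posPow (a - 1) (s - r)) :=
        fun r hr => by
          have h1 : 0 < 1 - r := by linarith [hr.2]
          have h2 : 0 < s - r := sub_pos.2 hr.2
          have h3 := hr.1
          rw [posPow_zero_of_pos hs.1, one_mul, posPow_of_pos h3, posPow_of_pos h1s,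
            posPow_of_pos h1, posPow_of_pos h2, ENNReal.ofReal_mul (by positivity),
            ENNReal.ofReal_mul (by positivity), ENNReal.ofReal_mul (by positivity)]
      rw [setLIntegral_congr_fun measurableSet_Ioo hl, setLIntegral_eq_of_support_subset]
      refine Function.support_subset_iff'.2 fun r hr => ?_
      rcases lt_or_ge 0 r with h | h
      · rw [posPow_of_nonpos (x := s - r) (not_lt.1 fun h' => hr ⟨h, by linarith⟩)]
        simp
      · rw [posPow_of_nonpos h]
        simp
    · refine (ae_restrict_iff' measurableSet_Ioo).2 (Eventually.of_forall fun r hr => ?_)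
      have h1 : 0 < 1 - r := by linarith [hr.2]
      have h2 : 0 < s - r := sub_pos.2 hr.2
      have h3 := hr.1
      simp only [Pi.zero_apply]
      positivity
    · exact Measurable.aestronglyMeasurable (by fun_prop)
  rw [intervalIntegral.integral_of_le zero_le_one, integral_Ioc_eq_integral_Ioo,
    setIntegral_congr_fun measurableSet_Ioo hin]
  have hmo : Measurable fun s => ∫⁻ r, posPow 0 s * (posPow (-a) r * posPow (a / 2 - 1) (1 - s) *
      posPow (a / 2 - 1) (1 - r) * posPow (a - 1) (s - r)) := hm.lintegral_prod_right'
  have hset : ∫⁻ s in Ioo 0 1, ∫⁻ r, posPow 0 s * (posPow (-a) r * posPow (a / 2 - 1) (1 - s) *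
      posPow (a / 2 - 1) (1 - r) * posPow (a - 1) (s - r)) = triangleL a 1 := by
    rw [setLIntegral_eq_of_support_subset, triangleL]
    refine Function.support_subset_iff'.2 fun s hs => ?_
    refine (lintegral_congr fun r => ?_).trans lintegral_zero
    rcases lt_or_ge 0 s with h | h
    · rw [posPow_of_nonpos (x := 1 - s) (not_lt.1 fun h' => hs ⟨h, by linarith⟩)]
      simp
    · rw [posPow_of_nonpos h, zero_mul]
  -- Passing `toReal` through the outer integral requires the inner one to be finite almost
  -- everywhere, which follows from finiteness of the double integral.
  rw [integral_toReal hmo.aemeasurable, hset]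
  refine ae_lt_top hmo ?_
  rw [hset]
  exact triangleL_ne_top ha

include ht

theorem integral_productCut_mul_productCut :
    ∫ p, productCut a t p * productCut a t p = t ^ (2 - 2 * a) / (1 - a) ^ 2 := by
  have ha1 := sub_pos.2 ha.2
  have h := isRepresentedBy_productCut ha t
  rw [h.integral_mul h, lintegral_productL_mul_productL ha, ENNReal.toReal_pow, ENNReal.toReal_mul,
    ENNReal.toReal_ofReal (by positivity), toReal_posPow_of_nonneg ht ha1.ne', mul_pow,
    ← Real.rpow_natCast (t ^ (1 - a)), ← Real.rpow_mul ht]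
  rw [show (1 - a) * ((2 : ℕ) : ℝ) = 2 - 2 * a by push_cast; ring]
  field_simp

theorem integral_singularCut_mul_productCut :
    ∫ p, singularCut a t p * productCut a t p = 2 * t * beta (1 - a) a := by
  have ha0 := ha.1
  have ha1 := sub_pos.2 ha.2
  have hb := beta_pos ha1 (show 0 < a by linarith)
  rw [(isRepresentedBy_singularCut ha t).integral_mul (isRepresentedBy_productCut ha t),
    lintegral_singularL_mul_productL ha, ENNReal.toReal_mul, ENNReal.toReal_mul,
    ENNReal.toReal_ofReal hb.le, toReal_posPow_of_nonneg ht one_ne_zero, Real.rpow_one]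
  simp only [ENNReal.toReal_ofNat]
  ring

theorem integral_singularCut_mul_singularCut :
    ∫ p, singularCut a t p * singularCut a t p = t ^ (2 * a) / a * beta (1 - a) (2 * a - 1) := by
  have ha0 := ha.1
  have ha1 := sub_pos.2 ha.2
  have hb := beta_pos ha1 (show 0 < 2 * a - 1 by linarith)
  have h := isRepresentedBy_singularCut ha t
  rw [h.integral_mul h, lintegral_singularL_mul_singularL ha, ENNReal.toReal_mul,
    ENNReal.toReal_mul, ENNReal.toReal_mul, ENNReal.toReal_ofReal hb.le,
    ENNReal.toReal_ofReal (by positivity), toReal_posPow_of_nonneg ht (by positivity)]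
  simp only [ENNReal.toReal_ofNat]
  field_simp

omit ht in
theorem integral_Q_mul_eq {G : ℝ × ℝ → ℝ} {G' : ℝ → ℝ → ℝ≥0∞} (hG : IsRepresentedBy G G') :
    ∫ p : ℝ × ℝ, Q a t p.1 p.2 * G p =
      kernelConst a * (∫⁻ x, ∫⁻ y, rosenblattL a t x y * G' x y).toReal := by
  rw [(isRepresentedBy_Q ha t).integral_mul hG]
  have : ∫⁻ x, ∫⁻ y, (ENNReal.ofReal (kernelConst a) * rosenblattL a t x y) * G' x y =
      ENNReal.ofReal (kernelConst a) * ∫⁻ x, ∫⁻ y, rosenblattL a t x y * G' x y := by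
    rw [← lintegral_const_mul' _ _ ENNReal.ofReal_ne_top]
    refine lintegral_congr fun x => ?_
    rw [← lintegral_const_mul' _ _ ENNReal.ofReal_ne_top]
    exact lintegral_congr fun y => mul_assoc _ _ _
  rw [this, ENNReal.toReal_mul, ENNReal.toReal_ofReal (kernelConst_nonneg ha)]

theorem integral_Q_mul_productCut :
    ∫ p : ℝ × ℝ, Q a t p.1 p.2 * productCut a t p = C₁ a * t := by
  have ha0 := ha.1
  have ha1 := sub_pos.2 ha.2
  have hb := beta_pos ha1 (show 0 < a / 2 by linarith)
  rw [integral_Q_mul_eq ha (isRepresentedBy_productCut ha t),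
    lintegral_rosenblattL_mul_productL ha, ENNReal.toReal_mul, ENNReal.toReal_pow,
    ENNReal.toReal_ofReal hb.le, toReal_posPow_of_nonneg ht one_ne_zero, Real.rpow_one, C₁,
    kernelConst]
  ring

theorem integral_Q_mul_singularCut :
    ∫ p : ℝ × ℝ, Q a t p.1 p.2 * singularCut a t p = t ^ (2 * a) / a * C₂ a := by
  have ha0 := ha.1
  rw [integral_Q_mul_eq ha (isRepresentedBy_singularCut ha t),
    lintegral_rosenblattL_mul_singularL ha, ENNReal.toReal_mul, ENNReal.toReal_mul,
    ENNReal.toReal_mul, ENNReal.toReal_ofReal (by positivity),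
    toReal_posPow_of_nonneg ht (by positivity), C₂, integral_eq_toReal_triangleL ha, kernelConst]
  simp only [ENNReal.toReal_ofNat]
  field_simp

omit ht in
-- The normalizations are made for this: `c_{a'}² B(1-a, a/2) = a(a+1)/2`, and `d_a` turns its
-- square into the factor that cancels `1/(a(2a-1))` in the norm of `Q`.
theorem kernelConst_sq_mul_beta_sq :
    (kernelConst a * beta (1 - a) (a / 2)) ^ 2 = a * (2 * a - 1) / 2 := by
  have ha0 := ha.1
  have ha1 := sub_pos.2 ha.2
  have hb := beta_pos ha1 (show 0 < a / 2 by linarith)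
  have h2a : 0 < 2 * a - 1 := by linarith
  have hpos : 0 < a := by linarith
  have e1 : 2 - 2 * ((a + 1) / 2) = 1 - a := by ring
  have e2 : (a + 1) / 2 - 1 / 2 = a / 2 := by ring
  have e3 : 2 * ((a + 1) / 2) - 1 = a := by ring
  have hc : cConst ((a + 1) / 2) ^ 2 = (a + 1) / 2 * a / beta (1 - a) (a / 2) := by
    rw [cConst, Real.sq_sqrt, e1, e2, e3]
    rw [e1, e2, e3]
    positivity
  have hd : dConst a ^ 2 = (1 / (a + 1)) ^ 2 * (2 * (2 * a - 1) / a) := by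
    rw [dConst, mul_pow, Real.sq_sqrt (by positivity)]
  calc _ = dConst a ^ 2 * (cConst ((a + 1) / 2) ^ 2 * beta (1 - a) (a / 2)) ^ 2 := by
        rw [kernelConst]; ring
    _ = _ := by
        rw [hd, hc]
        field_simp

theorem integral_Q_mul_Q :
    ∫ p : ℝ × ℝ, Q a t p.1 p.2 * Q a t p.1 p.2 = t ^ (2 * a) / 2 := by
  have ha0 := ha.1
  have ha1 := sub_pos.2 ha.2
  have hb := beta_pos ha1 (show 0 < a / 2 by linarith)
  have h2a : 0 < 2 * a - 1 := by linarith
  have hpos : 0 < a := by linarith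
  have h := isRepresentedBy_Q ha t
  rw [h.integral_mul h, lintegral_const_mul_rosenblattL_sq,
    lintegral_rosenblattL_mul_rosenblattL ha, ENNReal.toReal_mul, ENNReal.toReal_mul,
    ENNReal.toReal_mul, ENNReal.toReal_mul, ENNReal.toReal_mul, ENNReal.toReal_pow,
    ENNReal.toReal_pow, ENNReal.toReal_ofReal (kernelConst_nonneg ha), ENNReal.toReal_ofReal hb.le,
    ENNReal.toReal_ofReal (by positivity), ENNReal.toReal_ofReal (by positivity),
    toReal_posPow_of_nonneg ht (by positivity), ← mul_assoc, ← mul_pow,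
    kernelConst_sq_mul_beta_sq ha]
  simp only [ENNReal.toReal_ofNat]
  have h2a' := h2a.ne'
  generalize 2 * a - 1 = c at *
  field_simp

end

/-! ### Tensor products of kernels -/

/-- The function `F(y₁, y₂) G(u₁, u₂)` of `((y₁, u₁), (y₂, u₂))`. -/
def tensor (F G : ℝ × ℝ → ℝ) (p : (ℝ × ℝ) × (ℝ × ℝ)) : ℝ := F (p.1.1, p.2.1) * G (p.1.2, p.2.2)

/-- Regrouping `((y₁, u₁), (y₂, u₂))` as `((y₁, y₂), (u₁, u₂))` is a chain of reassociations and one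
swap of the middle coordinates. -/
theorem measurePreserving_prodProdProdComm :
    MeasurePreserving (Homeomorph.prodProdProdComm ℝ ℝ ℝ ℝ) volume volume := by
  have h1 : MeasurePreserving (Prod.map id (MeasurableEquiv.prodAssoc.symm :
      ℝ × ℝ × ℝ → (ℝ × ℝ) × ℝ) : ℝ × ℝ × ℝ × ℝ → ℝ × (ℝ × ℝ) × ℝ) volume volume :=
    (MeasurePreserving.id volume).prod (volume_preserving_prodAssoc.symm _)
  have h2 : MeasurePreserving (Prod.map id (Prod.map Prod.swap id) :
      ℝ × (ℝ × ℝ) × ℝ → ℝ × (ℝ × ℝ) × ℝ) volume volume :=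
    (MeasurePreserving.id volume).prod
      (Measure.measurePreserving_swap.prod (MeasurePreserving.id volume))
  have h3 : MeasurePreserving (Prod.map id (MeasurableEquiv.prodAssoc :
      (ℝ × ℝ) × ℝ → ℝ × ℝ × ℝ) : ℝ × (ℝ × ℝ) × ℝ → ℝ × ℝ × ℝ × ℝ) volume volume :=
    (MeasurePreserving.id volume).prod volume_preserving_prodAssoc
  have h0 : MeasurePreserving (MeasurableEquiv.prodAssoc :
      (ℝ × ℝ) × (ℝ × ℝ) → ℝ × ℝ × ℝ × ℝ) volume volume := volume_preserving_prodAssoc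
  exact (volume_preserving_prodAssoc.symm _).comp (h3.comp (h2.comp (h1.comp h0)))

theorem memLp_tensor {F G : ℝ × ℝ → ℝ} (hF : MemLp F 2 volume) (hG : MemLp G 2 volume) :
    MemLp (tensor F G) 2 volume := by
  have h : MemLp (fun z : (ℝ × ℝ) × (ℝ × ℝ) => F z.1 * G z.2) 2 volume := by
    have hm : AEStronglyMeasurable (fun z : (ℝ × ℝ) × (ℝ × ℝ) => F z.1 * G z.2)
        (volume.prod volume) :=
      (hF.1.comp_quasiMeasurePreserving Measure.quasiMeasurePreserving_fst).mul
        (hG.1.comp_quasiMeasurePreserving Measure.quasiMeasurePreserving_snd)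
    rw [Measure.volume_eq_prod]
    refine (memLp_two_iff_integrable_sq hm).2 ?_
    refine (hF.integrable_sq.mul_prod hG.integrable_sq).congr (Eventually.of_forall fun z => ?_)
    simp only [mul_pow]
  exact h.comp_measurePreserving measurePreserving_prodProdProdComm

theorem integral_tensor_mul_tensor (F G F' G' : ℝ × ℝ → ℝ) :
    ∫ p, tensor F G p * tensor F' G' p = (∫ p, F p * F' p) * ∫ p, G p * G' p := by
  have h := measurePreserving_prodProdProdComm.integral_comp
    (Homeomorph.prodProdProdComm ℝ ℝ ℝ ℝ).measurableEmbedding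
    fun z : (ℝ × ℝ) × (ℝ × ℝ) => (F z.1 * F' z.1) * (G z.2 * G' z.2)
  rw [Measure.volume_eq_prod (ℝ × ℝ) (ℝ × ℝ), integral_prod_mul (fun z => F z * F' z)
    fun z => G z * G' z, ← Measure.volume_eq_prod] at h
  rw [← h]
  refine integral_congr_ae (Eventually.of_forall fun p => ?_)
  simp only [tensor, Homeomorph.prodProdProdComm]
  change F (p.1.1, p.2.1) * G (p.1.2, p.2.2) * (F' (p.1.1, p.2.1) * G' (p.1.2, p.2.2)) =
    (F (p.1.1, p.2.1) * F' (p.1.1, p.2.1)) * (G (p.1.2, p.2.2) * G' (p.1.2, p.2.2))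
  ring

theorem integral_sub_linear_combination_sq {α : Type*} [MeasurableSpace α] {μ : Measure α}
    {u v w : α → ℝ} (hu : MemLp u 2 μ) (hv : MemLp v 2 μ) (hw : MemLp w 2 μ) (k l : ℝ) :
    ∫ x, (u x - (k * v x + l * w x)) * (u x - (k * v x + l * w x)) ∂μ =
      ∫ x, u x * u x ∂μ - 2 * k * ∫ x, u x * v x ∂μ - 2 * l * ∫ x, u x * w x ∂μ +
        k ^ 2 * ∫ x, v x * v x ∂μ + 2 * k * l * ∫ x, w x * v x ∂μ + l ^ 2 * ∫ x, w x * w x ∂μ := by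
  simp only [← inner_toLp hu hu, ← inner_toLp hu hv, ← inner_toLp hu hw, ← inner_toLp hv hv,
    ← inner_toLp hw hv, ← inner_toLp hw hw]
  have hs := hu.sub ((hv.const_smul k).add (hw.const_smul l))
  have e := inner_toLp hs hs
  rw [MemLp.toLp_sub hu ((hv.const_smul k).add (hw.const_smul l)),
    MemLp.toLp_add (hv.const_smul k) (hw.const_smul l), MemLp.toLp_const_smul k hv,
    MemLp.toLp_const_smul l hw] at e
  simp only [Pi.sub_apply, Pi.add_apply, Pi.smul_apply, smul_eq_mul] at e
  rw [← e]
  simp only [inner_sub_left, inner_sub_right, inner_add_left, inner_add_right,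
    real_inner_smul_left, real_inner_smul_right]
  rw [real_inner_comm (hu.toLp u) (hv.toLp v), real_inner_comm (hu.toLp u) (hw.toLp w),
    real_inner_comm (hw.toLp w) (hv.toLp v)]
  ring

/-! ### The mean square error -/

theorem sheetKernel_eq_tensor (α β t s : ℝ) :
    sheetKernel α β t s = tensor (fun p => Q α t p.1 p.2) (fun p => Q β s p.1 p.2) := rfl

theorem cutoff_zeta_eq (α β k₁ k₂ t s : ℝ) (p : (ℝ × ℝ) × (ℝ × ℝ)) :
    cutoff (zeta α β k₁ k₂) t s p =
      k₁ * tensor (productCut α t) (productCut β s) p +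
        k₂ * tensor (singularCut α t) (singularCut β s) p := by
  by_cases h1 : p.1.1 ∈ Icc 0 t ∧ p.2.1 ∈ Icc 0 t
  · by_cases h2 : p.1.2 ∈ Icc 0 s ∧ p.2.2 ∈ Icc 0 s
    · rw [cutoff, indicator_of_mem (show p ∈ (Icc 0 t ×ˢ Icc 0 s) ×ˢ (Icc 0 t ×ˢ Icc 0 s) from
        ⟨⟨h1.1, h2.1⟩, ⟨h1.2, h2.2⟩⟩), tensor, tensor, productCut, productCut, singularCut,
        singularCut, indicator_of_mem (show (p.1.1, p.2.1) ∈ Icc 0 t ×ˢ Icc 0 t from h1),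
        indicator_of_mem (show (p.1.2, p.2.2) ∈ Icc 0 s ×ˢ Icc 0 s from h2),
        indicator_of_mem (show (p.1.1, p.2.1) ∈ Icc 0 t ×ˢ Icc 0 t from h1),
        indicator_of_mem (show (p.1.2, p.2.2) ∈ Icc 0 s ×ˢ Icc 0 s from h2), zeta]
      ring
    · rw [cutoff, indicator_of_notMem fun h => h2 ⟨h.1.2, h.2.2⟩, tensor, tensor,
        productCut, productCut, singularCut, singularCut,
        indicator_of_notMem (a := (p.1.2, p.2.2)) fun h => h2 h,
        indicator_of_notMem (a := (p.1.2, p.2.2)) fun h => h2 h]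
      ring
  · rw [cutoff, indicator_of_notMem fun h => h1 ⟨h.1.1, h.2.1⟩, tensor, tensor,
      productCut, productCut, singularCut, singularCut,
      indicator_of_notMem (a := (p.1.1, p.2.1)) fun h => h1 h,
      indicator_of_notMem (a := (p.1.1, p.2.1)) fun h => h1 h]
    ring

theorem sheetKernel_swap (α β t s : ℝ) (p : (ℝ × ℝ) × (ℝ × ℝ)) :
    sheetKernel α β t s p.swap = sheetKernel α β t s p := by
  simp only [sheetKernel, Prod.fst_swap, Prod.snd_swap]
  rw [Q_comm, Q_comm s]

theorem productCut_swap (a t x y : ℝ) : productCut a t (x, y) = productCut a t (y, x) := by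
  simp only [productCut, Set.indicator, Set.mem_prod, and_comm, mul_comm]

theorem singularCut_swap (a t x y : ℝ) : singularCut a t (x, y) = singularCut a t (y, x) := by
  simp only [singularCut, Set.indicator, Set.mem_prod, and_comm, singularKernel, max_comm x y,
    min_comm x y, abs_sub_comm x y]

theorem cutoff_zeta_swap (α β k₁ k₂ t s : ℝ) (p : (ℝ × ℝ) × (ℝ × ℝ)) :
    cutoff (zeta α β k₁ k₂) t s p.swap = cutoff (zeta α β k₁ k₂) t s p := by
  simp only [cutoff_zeta_eq, tensor, Prod.fst_swap, Prod.snd_swap]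
  rw [productCut_swap, productCut_swap β, singularCut_swap, singularCut_swap β]

theorem ae_coordinates_ne_zero :
    ∀ᵐ p : (ℝ × ℝ) × (ℝ × ℝ), p.1.1 ≠ 0 ∧ p.1.2 ≠ 0 ∧ p.2.1 ≠ 0 ∧ p.2.2 ≠ 0 := by
  have h := ae_pair_ne (c := 0)
  rw [Measure.volume_eq_prod]
  filter_upwards [Measure.quasiMeasurePreserving_fst.ae h,
    Measure.quasiMeasurePreserving_snd.ae h] with p h1 h2 using ⟨h1.1, h1.2, h2.1, h2.2⟩

theorem ae_eq_zero_of_eq_zero {g : (ℝ × ℝ) × (ℝ × ℝ) → ℝ}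
    (hg : ∀ p, ¬ (0 ≤ p.1.1 ∧ 0 ≤ p.1.2 ∧ 0 ≤ p.2.1 ∧ 0 ≤ p.2.2) → g p = 0) :
    ∀ᵐ p, ¬ (0 < p.1.1 ∧ 0 < p.1.2 ∧ 0 < p.2.1 ∧ 0 < p.2.2) → g p = 0 := by
  filter_upwards [ae_coordinates_ne_zero] with p hp hn
  exact hg p fun h => hn ⟨h.1.lt_of_ne' hp.1, h.2.1.lt_of_ne' hp.2.1, h.2.2.1.lt_of_ne' hp.2.2.1,
    h.2.2.2.lt_of_ne' hp.2.2.2⟩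

theorem sheetKernel_eq_zero (α β t s : ℝ) (p : (ℝ × ℝ) × (ℝ × ℝ))
    (hp : ¬ (0 ≤ p.1.1 ∧ 0 ≤ p.1.2 ∧ 0 ≤ p.2.1 ∧ 0 ≤ p.2.2)) : sheetKernel α β t s p = 0 := by
  rw [sheetKernel]
  by_contra hne
  obtain ⟨h1, h2⟩ := mul_ne_zero_iff.1 hne
  refine hp ⟨?_, ?_, ?_, ?_⟩
  · by_contra h; exact h1 (Q_eq_zero_of_notMem_left fun h' => h h'.1)
  · by_contra h; exact h2 (Q_eq_zero_of_notMem_left fun h' => h h'.1)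
  · by_contra h; exact h1 (Q_eq_zero_of_notMem_right fun h' => h h'.1)
  · by_contra h; exact h2 (Q_eq_zero_of_notMem_right fun h' => h h'.1)

end RosenblattSheet

theorem theorem2p1 {Ω : Type*} [MeasurableSpace Ω] (P : Measure Ω) [IsProbabilityMeasure P]
    (B : ℝ≥0 × ℝ≥0 → Ω → ℝ) (hB : RosenblattSheet.IsBrownianSheet B P)
    (α β : ℝ) (hα : α ∈ Ioo (1 / 2 : ℝ) 1) (hβ : β ∈ Ioo (1 / 2 : ℝ) 1)
    (k₁ k₂ : ℝ) (hk₁ : 0 ≤ k₁) (hk₂ : 0 ≤ k₂) (t s : ℝ) (ht : 0 ≤ t) (hs : 0 ≤ s) :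
    -- both double Wiener integrals exist (in particular they are square integrable)
    RosenblattSheet.IsDoubleWienerIntegral B P (RosenblattSheet.sheetKernel α β t s)
      (RosenblattSheet.rosenblattSheet B P α β t s) ∧
    RosenblattSheet.IsDoubleWienerIntegral B P
      (RosenblattSheet.cutoff (RosenblattSheet.zeta α β k₁ k₂) t s)
      (RosenblattSheet.M B P (RosenblattSheet.zeta α β k₁ k₂) t s) ∧
    -- and the mean square error has the closed form
    RosenblattSheet.f B P α β t s k₁ k₂ =
      RosenblattSheet.aCoeff α β k₂ * t ^ (2 * α) * s ^ (2 * β)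
        - 8 * k₁ * RosenblattSheet.bCoeff α β k₂ * t * s
        + 4 * k₁ ^ 2 * (t ^ (2 - 2 * α) * s ^ (2 - 2 * β) / ((1 - α) ^ 2 * (1 - β) ^ 2)) := by
  open RosenblattSheet in
  have hq : MemLp (sheetKernel α β t s) 2 volume :=
    memLp_tensor (isRepresentedBy_Q hα t).memLp (isRepresentedBy_Q hβ s).memLp
  have hp := memLp_tensor (isRepresentedBy_productCut hα t).memLp
    (isRepresentedBy_productCut hβ s).memLp
  have hσ := memLp_tensor (isRepresentedBy_singularCut hα t).memLp
    (isRepresentedBy_singularCut hβ s).memLp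
  have hζ : MemLp (cutoff (zeta α β k₁ k₂) t s) 2 volume := by
    rw [funext (cutoff_zeta_eq α β k₁ k₂ t s)]
    exact (hp.const_mul k₁).add (hσ.const_mul k₂)
  have hZ : IsDoubleWienerIntegral B P (sheetKernel α β t s) (rosenblattSheet B P α β t s) :=
    isDoubleWienerIntegral_doubleWienerIntegral hB hq
      (ae_eq_zero_of_eq_zero (sheetKernel_eq_zero α β t s))
  have hM : IsDoubleWienerIntegral B P (cutoff (zeta α β k₁ k₂) t s)
      (M B P (zeta α β k₁ k₂) t s) :=
    isDoubleWienerIntegral_doubleWienerIntegral hB hζ (ae_eq_zero_of_eq_zero fun p hp =>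
      indicator_of_notMem (fun h => hp ⟨h.1.1.1, h.1.2.1, h.2.1.1, h.2.2.1⟩) _)
  refine ⟨hZ, hM, ?_⟩
  -- The isometry contributes a factor `2`, which with the one in `f` makes `4`; it normalizes `‖Q_α
  -- ⊗ Q_β‖² = t^{2α} s^{2β} / 4` to leading coefficient `1`.
  rw [f, hZ.integral_sub_sq hB hM (sheetKernel_swap α β t s) (cutoff_zeta_swap α β k₁ k₂ t s)]
  simp only [cutoff_zeta_eq]
  rw [integral_sub_linear_combination_sq hq hp hσ, sheetKernel_eq_tensor]
  simp only [integral_tensor_mul_tensor, integral_Q_mul_Q hα ht, integral_Q_mul_Q hβ hs,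
    integral_Q_mul_productCut hα ht, integral_Q_mul_productCut hβ hs,
    integral_Q_mul_singularCut hα ht, integral_Q_mul_singularCut hβ hs,
    integral_productCut_mul_productCut hα ht, integral_productCut_mul_productCut hβ hs,
    integral_singularCut_mul_productCut hα ht, integral_singularCut_mul_productCut hβ hs,
    integral_singularCut_mul_singularCut hα ht, integral_singularCut_mul_singularCut hβ hs]
  have hα0 : α ≠ 0 := by linarith [hα.1]
  have hβ0 : β ≠ 0 := by linarith [hβ.1]
  have hα1 : 1 - α ≠ 0 := by linarith [hα.2]
  have hβ1 : 1 - β ≠ 0 := by linarith [hβ.2]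
  rw [aCoeff, bCoeff]
  field_simp
  ring
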